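/- Let $\ell\ge 1$ and $n\ge 0$ be integers, and let $t=(t_1,\dots,t_\ell)$, $x=(x_1,\dots,x_n)$, $y=(y_1,\dots,y_n)$ and $\eta$ be indeterminates. Let $\mathcal P_{\ell,n}$ be the set of sequences $\lambda=(\lambda_1,\dots,\lambda_\ell)$ of integers with $n\ge\lambda_1\ge\dots\ge\lambda_\ell\ge1$, and for such $\lambda$ let $\omega_{k,\lambda}=\#\{a:\lambda_a=k\}$. For $1\le m\le n$ set $$X_m(u;x;y)=u\prod_{1\le k<m}(u-y_k)\prod_{m<k\le n}(u-x_k),$$ and for $\lambda\in\mathcal P_{\ell,n}$ set $$P_\lambda(t;x;y;\eta)=\Bigl(\prod_{m=1}^n\prod_{s=1}^{\omega_{m,\lambda}}\frac{1-\eta}{1-\eta^s}\Bigr)\sum_{\sigma\in S_\ell}\Bigl(\prod_{a=1}^\ell X_{\lambda_a}(t_{\sigma_a};x;y)\prod_{1\le a<b\le\ell}\frac{t_{\sigma_a}-\eta t_{\sigma_b}}{t_{\sigma_a}-t_{\sigma_b}}\Bigr).$$ (a) Every $P_\lambda$ is a polynomial in $t,x,y,\eta$ with integer coefficients. If $1\le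 i<j\le n$ and $x_j=\eta^{\ell-1}y_i$, then $$\sum_{\lambda\,:\,j\ge\lambda_1\ge\dots\ge\lambda_\ell\ge i}c^{(i,j)}_\lambda(x;y;\eta)\,P_\lambda(t;x;y;\eta)=0,$$ where $$c^{(i,j)}_\lambda(x;y;\eta)=(-1)^{\omega_{i,\lambda}}\,\eta^{\omega_{j,\lambda}(\omega_{j,\lambda}-1)/2}\prod_{i<k<j}\ \prod_{s=0}^{\omega_{k,\lambda}-1}(x_k-\eta^sy_k)\ \prod_{a=1}^\ell\Bigl(\prod_{i<k<\lambda_a}(\eta^{\ell-a}y_i-x_k)\prod_{\lambda_a<m<j}(\eta^{\ell-a}y_i-y_m)\Bigr).$$ The relation holds whenever $t,x,y,\eta$ take values in a commutative ring and satisfy $x_j=\eta^{\ell-1}y_i$. (b) The case $i=1$, $j=n=2$ is Jing's identity: let $t_1,\dots,t_\ell$ be distinct elements of a field $F$, let $\eta\in F$ with $\eta^s\ne1$ for $1\le s\le\ell$, and for $0\le k\le\ell$ put $$J_k=\prod_{s=0}^{k-1}\frac{\eta^\ell-\eta^s}{1-\eta^{s+1}}\ \sum_{\sigma\in S_\ell}\Bigl(\prod_{1\le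 a\le k}(t_{\sigma_a}-1)\prod_{k<b\le\ell}(t_{\sigma_b}-\eta^{\ell-1})\prod_{1\le a<b\le\ell}\frac{t_{\sigma_a}-\eta t_{\sigma_b}}{t_{\sigma_a}-t_{\sigma_b}}\Bigr).$$ If $n=2$, $y_1=1$ and $x_2=\eta^{\ell-1}$, then for every $\lambda\in\mathcal P_{\ell,2}$ $$c^{(1,2)}_\lambda P_\lambda=(-1)^\ell\,\Bigl(\prod_{s=1}^\ell\frac{1-\eta}{1-\eta^s}\Bigr)\,t_1\cdots t_\ell\;J_{\omega_{2,\lambda}},$$ and $\sum_{k=0}^\ell J_k=0$. -/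

import Mathlib

open Finset

namespace JingId

/-- Partitions `lam_1 ≥ … ≥ lam_ℓ` with parts in `{1, …, n}`. Here and below all indices are
shifted by one: the part `m` is the element `m - 1` of `Fin n`, and the position `a` of a part
is the element `a - 1` of `Fin ℓ`. -/
def partitions (ℓ n : ℕ) : Finset (Fin ℓ → Fin n) :=
  univ.filter fun lam => ∀ a b : Fin ℓ, a ≤ b → lam b ≤ lam a

/-- The partitions all of whose parts lie between `i` and `j`. -/
def partitionsBetween (ℓ : ℕ) {n : ℕ} (i j : Fin n) : Finset (Fin ℓ → Fin n) :=
  (partitions ℓ n).filter fun lam => ∀ a, i ≤ lam a ∧ lam a ≤ j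

/-- The multiplicity of the part `k` in `lam`. -/
def mult {ℓ n : ℕ} (k : Fin n) (lam : Fin ℓ → Fin n) : ℕ :=
  #{a | lam a = k}

/-- `X_m(u; x; y) = u ∏_{k < m} (u - y_k) ∏_{m < k ≤ n} (u - x_k)`. -/
def X {A : Type*} [CommRing A] {n : ℕ} (m : Fin n) (u : A) (x y : Fin n → A) : A :=
  u * (∏ k ∈ Iio m, (u - y k)) * ∏ k ∈ Ioi m, (u - x k)

/-- `r_lam(η) = ∏_m ∏_{s=1}^{ω_m} (1 - η) / (1 - η^s)`, with `ω_m` the multiplicity of `m`. -/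
def r {F : Type*} [Field F] {ℓ n : ℕ} (lam : Fin ℓ → Fin n) (eta : F) : F :=
  ∏ m : Fin n, ∏ s ∈ Icc 1 (mult m lam), (1 - eta) / (1 - eta ^ s)

/-- The formula defining `P_lam(t; x; y; η)`, evaluated at elements of a field. It has its
intended meaning when the `t_a` are pairwise distinct and `η^s ≠ 1` for `1 ≤ s ≤ ℓ`; in
particular when `t, x, y, η` are independent indeterminates. -/
def PFormula {F : Type*} [Field F] {ℓ n : ℕ} (lam : Fin ℓ → Fin n)
    (t : Fin ℓ → F) (x y : Fin n → F) (eta : F) : F :=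
  r lam eta * ∑ σ : Equiv.Perm (Fin ℓ),
    (∏ a, X (lam a) (t (σ a)) x y) *
      ∏ a, ∏ b ∈ Ioi a, (t (σ a) - eta * t (σ b)) / (t (σ a) - t (σ b))

/-- The coefficient `c_lam^{(i,j)}(x; y; η)`. The exponent `ℓ - a` becomes `ℓ - 1 - a` for the
shifted position `a < ℓ`. -/
def c {A : Type*} [CommRing A] {ℓ n : ℕ} (i j : Fin n) (lam : Fin ℓ → Fin n)
    (x y : Fin n → A) (eta : A) : A :=
  (-1) ^ mult i lam * eta ^ (mult j lam * (mult j lam - 1) / 2) *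
    (∏ k ∈ Ioo i j, ∏ s ∈ range (mult k lam), (x k - eta ^ s * y k)) *
    ∏ a : Fin ℓ,
      ((∏ k ∈ Ioo i (lam a), (eta ^ (ℓ - 1 - (a : ℕ)) * y i - x k)) *
        ∏ m ∈ Ioo (lam a) j, (eta ^ (ℓ - 1 - (a : ℕ)) * y i - y m))

/-- Names of the indeterminates `t_1, …, t_ℓ, x_1, …, x_n, y_1, …, y_n, η`. -/
inductive Indet (ℓ n : ℕ) : Type
  | t (a : Fin ℓ) : Indet ℓ n
  | x (m : Fin n) : Indet ℓ n
  | y (m : Fin n) : Indet ℓ n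
  | eta : Indet ℓ n

/-- The assignment giving the indeterminates prescribed values. -/
def Indet.assign {A : Type*} {ℓ n : ℕ} (t : Fin ℓ → A) (x y : Fin n → A) (eta : A) :
    Indet ℓ n → A
  | .t a => t a
  | .x m => x m
  | .y m => y m
  | .eta => eta

/-- The field of rational functions in all the indeterminates. -/
abbrev RatField (ℓ n : ℕ) : Type := FractionRing (MvPolynomial (Indet ℓ n) ℤ)

/-- An indeterminate as a rational function. -/
noncomputable def gen {ℓ n : ℕ} (v : Indet ℓ n) : RatField ℓ n :=
  algebraMap (MvPolynomial (Indet ℓ n) ℤ) (RatField ℓ n) (MvPolynomial.X v)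

/-- `P_lam` as a rational function of the indeterminates. -/
noncomputable def PRat {ℓ n : ℕ} (lam : Fin ℓ → Fin n) : RatField ℓ n :=
  PFormula lam (fun a => gen (.t a)) (fun m => gen (.x m)) (fun m => gen (.y m)) (gen .eta)

/-- The `k`-th term of the sum in Jing's identity. -/
def jingTerm {F : Type*} [Field F] {ℓ : ℕ} (k : ℕ) (t : Fin ℓ → F) (eta : F) : F :=
  (∏ s ∈ range k, (eta ^ ℓ - eta ^ s) / (1 - eta ^ (s + 1))) *
    ∑ σ : Equiv.Perm (Fin ℓ),
      (∏ a with (a : Fin ℓ).val < k, (t (σ a) - 1)) *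
        (∏ b with k ≤ (b : Fin ℓ).val, (t (σ b) - eta ^ (ℓ - 1))) *
        ∏ a, ∏ b ∈ Ioi a, (t (σ a) - eta * t (σ b)) / (t (σ a) - t (σ b))

end JingId

/-!
Write `h a b = (t_a - η t_b) / (t_a - t_b)`. Grouping the permutations `σ` in `P_lam` by the
rearrangement `f = lam ∘ σ⁻¹` of `lam`, the sum over the `σ` sorting a given `f` symmetrizes the pair
factors inside the fibres of `f` to the `η`-factorials which the prefactor `r lam` cancels
(`sum_perm_antitone`, resting on `∑_p ∏_{q ≠ p} h p q = (1 - η^N) / (1 - η)`). Hence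
`P_lam = ∑_f ∏_p X_{f p}(t_p) ∏_{f q < f p} h p q` over the rearrangements `f` of `lam`
(`r_mul_sum_perm`). The numerator over `∏_{a < b} (t_a - t_b)` vanishes when two of the `t_a`
agree, because exchanging two values of `f` changes its sign; the `t_a - t_b` being pairwise
non-associated primes, `P_lam` is a polynomial over `ℤ` (`prod_sub_dvd_numer`).

In the same way `∑ c_lam P_lam` is a sum over all maps `f` from positions to the levels between
`i` and `j`, and the weight of `f` is a product of factors attached to the levels
(`c_mul_weight_eq`). The levels are eliminated by the merging identity `splitSum_eq`: the weighted
sum over all splittings of a set `J` into a level and the levels below it, with `z = y_i`, is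
`(-1)^{#J} ∏_{a ∈ J} (e t_a - y) ∏_{s < #J} (η^s z - x)`. Both sides are polynomials in `z` of degree
at most `#J`; they agree at `z = t_p` by induction on `#J` and at `z = y / e`, where only one
splitting contributes. The right side is of the form that makes the next level fit, so the whole
sum has a closed product form (`sum_levelMaps_eq`). It contains the factor `∏_{s < ℓ} (η^s y_i - x_j)`,
which vanishes when `x_j = η^{ℓ-1} y_i`. The top level `j` enters with the degenerate homogeneous
parameters `e = 0`, `y = -1`.

The relation is proved over any field for distinct `t_a`, then for the indeterminates with `x_j`
replaced by `η^{ℓ-1} y_i`, and so for all values in commutative rings. The common factor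
`t_1 ⋯ t_ℓ` is split off at the start, so that Jing's identity, the case of two levels, also
follows when some `t_a` is zero.
-/

/-! ### The merging identity for two levels -/

namespace JingId

/-- The weighted sum over the ways to split `J` into a higher part `I` and a lower part `J \ I`,
with `h` the factor of a pair of elements in different parts. Levels carry homogeneous parameters
`(e, y)`: the value `e = 1` gives factors `x - η^s y`, while `e = 0`, `y = -1` gives the powers
of `η` in Jing's identity. -/
def splitSum {ι A : Type*} [DecidableEq ι] [CommRing A] (h : ι → ι → A) (t : ι → A)
    (e x y z eta : A) (J : Finset ι) : A :=
  ∑ I ∈ J.powerset, (-1) ^ #(J \ I) * (∏ s ∈ range #I, (e * x - eta ^ s * y)) *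
    (∏ s ∈ range #(J \ I), (e * eta ^ s * z - y)) * (∏ a ∈ I, (t a - z)) *
    (∏ b ∈ J \ I, (t b - x)) * ∏ a ∈ I, ∏ b ∈ J \ I, h a b

/-- The closed form of `splitSum`. -/
def splitProd {ι A : Type*} [CommRing A] (t : ι → A) (e x y z eta : A) (J : Finset ι) : A :=
  (-1) ^ #J * (∏ a ∈ J, (e * t a - y)) * ∏ s ∈ range #J, (eta ^ s * z - x)

section Map

variable {ι A B : Type*} [CommRing A] [CommRing B] (φ : A →+* B)
  (h : ι → ι → A) (t : ι → A) (e x y z eta : A) (J : Finset ι)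

theorem map_splitSum [DecidableEq ι] : φ (splitSum h t e x y z eta J) =
    splitSum (fun a b => φ (h a b)) (fun a => φ (t a)) (φ e) (φ x) (φ y) (φ z) (φ eta) J := by
  simp [splitSum, map_sum, map_prod]

theorem map_splitProd : φ (splitProd t e x y z eta J) =
    splitProd (fun a => φ (t a)) (φ e) (φ x) (φ y) (φ z) (φ eta) J := by
  simp [splitProd, map_prod]

end Map

theorem natDegree_prod_le_card {ι A : Type*} [CommRing A] (s : Finset ι)
    (f : ι → Polynomial A) (hf : ∀ i ∈ s, (f i).natDegree ≤ 1) :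
    (∏ i ∈ s, f i).natDegree ≤ #s := by
  refine (Polynomial.natDegree_prod_le s f).trans ?_
  simpa using Finset.sum_le_card_nsmul s (fun i => (f i).natDegree) 1 hf

theorem natDegree_C_mul_mul_le {A : Type*} [CommRing A] (a : A) (p q : Polynomial A) {m n k : ℕ}
    (hp : p.natDegree ≤ m) (hq : q.natDegree ≤ n) (hk : m + n ≤ k) :
    (Polynomial.C a * p * q).natDegree ≤ k := by
  refine Polynomial.natDegree_mul_le.trans ?_
  have := Polynomial.natDegree_C_mul_le a p
  omega

open Polynomial in
theorem natDegree_linear_sub_le {A : Type*} [CommRing A] (a b : A) :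
    (C a * Polynomial.X - C b).natDegree ≤ 1 := by
  compute_degree

open Polynomial in
theorem natDegree_splitSum_le {ι A : Type*} [DecidableEq ι] [CommRing A] (h : ι → ι → A)
    (t : ι → A) (e x y eta : A) (J : Finset ι) :
    (splitSum (fun a b => C (h a b)) (fun a => C (t a)) (C e) (C x) (C y) Polynomial.X
      (C eta) J).natDegree ≤ #J := by
  refine natDegree_sum_le_of_forall_le _ _ fun I hI => ?_
  have hI' := card_sdiff_add_card_eq_card (mem_powerset.1 hI)
  have key := natDegree_C_mul_mul_le
    ((-1) ^ #(J \ I) * (∏ s ∈ range #I, (e * x - eta ^ s * y)) * (∏ b ∈ J \ I, (t b - x)) *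
      ∏ a ∈ I, ∏ b ∈ J \ I, h a b)
    (∏ s ∈ range #(J \ I), (C (e * eta ^ s) * Polynomial.X - C y))
    (∏ a ∈ I, (C (t a) - Polynomial.X)) (m := #(J \ I)) (n := #I) (k := #J)
    ((natDegree_prod_le_card _ _ fun s _ => natDegree_linear_sub_le _ _).trans (by simp))
    (natDegree_prod_le_card _ _ fun a _ => by compute_degree) hI'.le
  convert key using 2
  simp only [map_mul, map_prod, map_sub, map_pow, map_neg, map_one]
  ring

open Polynomial in
theorem natDegree_splitProd_le {ι A : Type*} [CommRing A] (t : ι → A) (e x y eta : A)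
    (J : Finset ι) :
    (splitProd (fun a => C (t a)) (C e) (C x) (C y) Polynomial.X (C eta) J).natDegree ≤ #J := by
  have key := natDegree_C_mul_mul_le ((-1) ^ #J * ∏ a ∈ J, (e * t a - y)) 1
    (∏ s ∈ range #J, (C (eta ^ s) * Polynomial.X - C x)) (m := 0) (n := #J) (k := #J)
    (by simp)
    ((natDegree_prod_le_card _ _ fun s _ => natDegree_linear_sub_le _ _).trans (by simp)) (by simp)
  convert key using 2
  simp [splitProd, map_prod]

/-- At `z = t p` the element `p` has to lie in the lower part. -/
theorem splitSum_at_node {ι F : Type*} [DecidableEq ι] [Field F] (t : ι → F) (e x y eta : F)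
    (J : Finset ι) (p : ι) (hp : p ∈ J) (ht : Set.InjOn t J) :
    splitSum (fun a b => (t a - eta * t b) / (t a - t b)) t e x y (t p) eta J =
      -((e * t p - y) * (t p - x)) * splitSum (fun a b => (t a - eta * t b) / (t a - t b))
        t e x y (eta * t p) eta (J.erase p) := by
  unfold splitSum
  rw [mul_sum]
  symm
  refine sum_subset_zero_on_sdiff (powerset_mono.2 (erase_subset p J)) ?_ ?_
  · intro I hI
    simp only [mem_sdiff, mem_powerset, not_and, subset_erase] at hI
    have hpI : p ∈ I := by
      by_contra hpI
      exact hI.2 hI.1 hpI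
    rw [prod_eq_zero (f := fun a => t a - t p) hpI (sub_self _)]
    ring
  · intro I hI
    rw [mem_powerset, subset_erase] at hI
    obtain ⟨hIJ, hpI⟩ := hI
    have hJ : J \ I = insert p (J.erase p \ I) := by
      ext a
      simp only [mem_sdiff, mem_insert, mem_erase]
      grind
    have hp' : p ∉ J.erase p \ I := by simp
    rw [hJ, card_insert_of_notMem hp', prod_insert hp', prod_range_succ']
    simp_rw [prod_insert hp']
    rw [prod_mul_distrib]
    have h1 : (∏ a ∈ I, (t a - t p)) * ∏ a ∈ I, (t a - eta * t p) / (t a - t p) =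
        ∏ a ∈ I, (t a - eta * t p) := by
      rw [← prod_mul_distrib]
      refine prod_congr rfl fun a ha => mul_div_cancel₀ _ (sub_ne_zero.2 fun hap => ?_)
      exact hpI (ht (hIJ ha) hp hap ▸ ha)
    rw [← h1]
    simp only [pow_succ, mul_assoc]
    ring

theorem splitProd_at_node {ι F : Type*} [DecidableEq ι] [Field F] (t : ι → F) (e x y eta : F)
    (J : Finset ι) (p : ι) (hp : p ∈ J) :
    splitProd t e x y (t p) eta J =
      -((e * t p - y) * (t p - x)) * splitProd t e x y (eta * t p) eta (J.erase p) := by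
  unfold splitProd
  obtain ⟨K, hK, rfl⟩ : ∃ K, p ∉ K ∧ insert p K = J := ⟨J.erase p, by simp, insert_erase hp⟩
  rw [erase_insert hK, card_insert_of_notMem hK, prod_insert hK, prod_range_succ']
  simp only [pow_succ, mul_assoc]
  ring

/-- At `z = y / e` only the splitting with empty lower part contributes. -/
theorem splitSum_at_ratio {ι F : Type*} [DecidableEq ι] [Field F] (h : ι → ι → F) (t : ι → F)
    (e x y eta : F) (J : Finset ι) (he : e ≠ 0) :
    splitSum h t e x y (y / e) eta J = splitProd t e x y (y / e) eta J := by
  unfold splitSum splitProd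
  rw [sum_eq_single J]
  · have h1 : ∏ a ∈ J, (e * t a - y) = e ^ #J * ∏ a ∈ J, (t a - y / e) := by
      rw [← prod_const, ← prod_mul_distrib]
      exact prod_congr rfl fun a _ => by field_simp
    have h2 : ∏ s ∈ range #J, (e * x - eta ^ s * y) =
        (-1) ^ #J * e ^ #J * ∏ s ∈ range #J, (eta ^ s * (y / e) - x) := by
      rw [← mul_pow, show (-1 * e) ^ #J = ∏ _s ∈ range #J, (-1 * e) by simp, ← prod_mul_distrib]
      exact prod_congr rfl fun s _ => by field_simp; ring
    rw [h1, h2]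
    simp
    ring
  · intro I hI hne
    have hcard : 0 ∈ range #(J \ I) := by
      rw [mem_range, card_pos, sdiff_nonempty]
      exact fun hJI => hne ((mem_powerset.1 hI).antisymm hJI)
    rw [prod_eq_zero (f := fun s => e * eta ^ s * (y / e) - y) hcard (by field_simp; simp)]
    ring
  · simp

open Polynomial in
/-- The merging identity when no factor `e * t p - y` of its right side vanishes and `e ≠ 0`. Then
`y / e` is a further interpolation point in `z`, besides the `#J` points `t p`, where the identity
reduces to `J \ {p}` with `z` replaced by `η * t p`. -/
theorem splitSum_eq_of_generic {ι F : Type*} [DecidableEq ι] [Field F] (t : ι → F)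
    (e x y z eta : F) (J : Finset ι) (ht : Set.InjOn t J) (he : e ≠ 0)
    (hy : ∀ p ∈ J, e * t p ≠ y) :
    splitSum (fun a b => (t a - eta * t b) / (t a - t b)) t e x y z eta J =
      splitProd t e x y z eta J := by
  classical
  induction hn : #J generalizing J z with
  | zero =>
    rw [card_eq_zero] at hn
    subst hn
    simp [splitSum, splitProd]
  | succ n ih =>
    -- both sides are polynomials in `z` of degree at most `#J`, compared at `#J + 1` points
    set h : ι → ι → F := fun a b => (t a - eta * t b) / (t a - t b) with hh
    have key : splitSum (fun a b => C (h a b)) (fun a => C (t a)) (C e) (C x) (C y) Polynomial.X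
        (C eta) J = splitProd (fun a => C (t a)) (C e) (C x) (C y) Polynomial.X (C eta) J := by
      have hc : #(insert (y / e) (J.image t)) = #J + 1 := by
        rw [card_insert_of_notMem, card_image_of_injOn ht]
        simp only [mem_image, not_exists, not_and]
        intro p hp hpe
        exact hy p hp (by rw [hpe]; field_simp)
      refine eq_of_degrees_lt_of_eval_finset_eq (insert (y / e) (J.image t)) ?_ ?_ ?_
      · rw [hc]
        exact degree_le_natDegree.trans_lt
          (by exact_mod_cast Nat.lt_succ_of_le (natDegree_splitSum_le h t e x y eta J))
      · rw [hc]
        exact degree_le_natDegree.trans_lt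
          (by exact_mod_cast Nat.lt_succ_of_le (natDegree_splitProd_le t e x y eta J))
      · intro w hw
        have e1 := map_splitSum (evalRingHom w) (fun a b => C (h a b)) (fun a => C (t a)) (C e)
          (C x) (C y) Polynomial.X (C eta) J
        have e2 := map_splitProd (evalRingHom w) (fun a => C (t a)) (C e)
          (C x) (C y) Polynomial.X (C eta) J
        simp only [coe_evalRingHom, eval_C, eval_X] at e1 e2
        rw [e1, e2]
        rcases mem_insert.1 hw with rfl | hw
        · exact splitSum_at_ratio h t e x y eta J he
        · obtain ⟨p, hp, rfl⟩ := mem_image.1 hw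
          rw [splitProd_at_node t e x y eta J p hp, ← ih (eta * t p) (J.erase p)
            (ht.mono (by simp)) (fun q hq => hy q (mem_of_mem_erase hq))
            (by rw [card_erase_of_mem hp, hn]; rfl)]
          exact splitSum_at_node t e x y eta J p hp ht
    have e1 := map_splitSum (evalRingHom z) (fun a b => C (h a b)) (fun a => C (t a)) (C e)
      (C x) (C y) Polynomial.X (C eta) J
    have e2 := map_splitProd (evalRingHom z) (fun a => C (t a)) (C e)
      (C x) (C y) Polynomial.X (C eta) J
    simp only [coe_evalRingHom, eval_C, eval_X] at e1 e2
    rw [← e1, ← e2, key]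

open Polynomial in
theorem splitSum_eq_of_infinite {ι F : Type*} [DecidableEq ι] [Field F] [Infinite F] (t : ι → F)
    (e x y z eta : F) (J : Finset ι) (ht : Set.InjOn t J) :
    splitSum (fun a b => (t a - eta * t b) / (t a - t b)) t e x y z eta J =
      splitProd t e x y z eta J := by
  classical
  set h : ι → ι → F := fun a b => (t a - eta * t b) / (t a - t b) with hh
  obtain ⟨c, hc⟩ := Infinite.exists_notMem_finset (J.image t)
  simp only [mem_image, not_exists, not_and] at hc
  -- move `(e, y)` along the line with direction `(1, c)`, where almost all points are generic
  set E : F[X] := C e + Polynomial.X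
  set Y : F[X] := C y + C c * Polynomial.X
  have e1 := fun w : F => map_splitSum (evalRingHom w) (fun a b => C (h a b)) (fun a => C (t a))
    E (C x) Y (C z) (C eta) J
  have e2 := fun w : F => map_splitProd (evalRingHom w) (fun a => C (t a))
    E (C x) Y (C z) (C eta) J
  simp only [coe_evalRingHom, eval_C, eval_X, E, Y, eval_add, eval_mul] at e1 e2
  have key : splitSum (fun a b => C (h a b)) (fun a => C (t a)) E (C x) Y (C z) (C eta) J =
      splitProd (fun a => C (t a)) E (C x) Y (C z) (C eta) J := by
    refine eq_of_infinite_eval_eq _ _ ?_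
    refine Set.Infinite.mono ?_
      (insert (-e) (J.image fun p => (e * t p - y) / (c - t p))).finite_toSet.infinite_compl
    intro w hw
    simp only [coe_insert, coe_image, Set.mem_compl_iff, Set.mem_insert_iff, Set.mem_image,
      mem_coe, not_or, not_exists, not_and] at hw
    simp only [Set.mem_ofPred_eq]
    rw [e1, e2]
    refine splitSum_eq_of_generic t _ x _ z eta J ht (fun h0 => hw.1 ?_) (fun p hp h0 => hw.2 p hp ?_)
    · linear_combination h0
    · have : c - t p ≠ 0 := sub_ne_zero.2 (Ne.symm (hc p hp))
      field_simp
      linear_combination h0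
  have := congrArg (eval 0) key
  rw [e1, e2] at this
  simpa using this

/-- The merging identity: the sum over all splittings of `J` into two adjacent levels has a closed
form, symmetric in the `t a` with no interaction between them. -/
theorem splitSum_eq {ι F : Type*} [DecidableEq ι] [Field F] (t : ι → F)
    (e x y z eta : F) (J : Finset ι) (ht : Set.InjOn t J) :
    splitSum (fun a b => (t a - eta * t b) / (t a - t b)) t e x y z eta J =
      splitProd t e x y z eta J := by
  -- pass to an infinite extension of `F`
  let φ : F →+* RatFunc F := algebraMap F (RatFunc F)
  have hφ : Function.Injective φ := φ.injective
  have : Infinite (RatFunc F) :=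
    Infinite.of_injective _ (IsFractionRing.injective (Polynomial F) (RatFunc F))
  apply hφ
  rw [map_splitSum, map_splitProd]
  simp only [map_div₀, map_sub, map_mul]
  exact splitSum_eq_of_infinite (fun a => φ (t a)) _ _ _ _ _ J (hφ.comp_injOn ht)

end JingId

/-! ### Summation over maps into several levels -/

namespace JingId

section Levels

variable {ι κ F : Type*} [DecidableEq ι] [LinearOrder κ]

/-- The maps sending `J` into `insert i L`. They take the irrelevant value `i` outside `J`, so that
they are determined by their restriction to `J`. -/
def levelMaps [Fintype ι] (i : κ) (L : Finset κ) (J : Finset ι) : Finset (ι → κ) :=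
  Fintype.piFinset fun a => if a ∈ J then insert i L else {i}

theorem mem_levelMaps [Fintype ι] {i : κ} {L : Finset κ} {J : Finset ι} {f : ι → κ} :
    f ∈ levelMaps i L J ↔ (∀ a ∈ J, f a = i ∨ f a ∈ L) ∧ ∀ a ∉ J, f a = i := by
  simp only [levelMaps, Fintype.mem_piFinset]
  constructor
  · intro hf
    refine ⟨fun a ha => ?_, fun a ha => ?_⟩
    · simpa [ha] using hf a
    · simpa [ha] using hf a
  · rintro ⟨h1, h2⟩ a
    by_cases ha : a ∈ J
    · simpa [ha] using h1 a ha
    · simpa [ha] using h2 a ha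

/-- The factors of the weight of `f : J → κ` that involve the parameters `(e, x, y)` of the
level `k`, together with the pair factors `h a b` for `f b < f a = k`. -/
def levelFactor [CommRing F] (h : ι → ι → F) (t : ι → F) (e x y : κ → F) (z eta : F)
    (J : Finset ι) (f : ι → κ) (k : κ) : F :=
  (∏ s ∈ range #{a ∈ J | f a = k}, (e k * x k - eta ^ s * y k)) *
    (∏ s ∈ range #{a ∈ J | f a < k}, (e k * eta ^ s * z - y k)) *
    (∏ a ∈ J with f a = k, (t a - z)) * (∏ b ∈ J with f b < k, (t b - x k)) *
    (∏ a ∈ J with k < f a, (e k * t a - y k)) *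
    (∏ s ∈ Ico #{a ∈ J | f a ≤ k} #J, (eta ^ s * z - x k)) *
    ∏ a ∈ J with f a = k, ∏ b ∈ J with f b < k, h a b

/-- A map into `insert i (insert m L)` amounts to its fibre `I` over `m` and a map of the rest. -/
theorem sum_levelMaps_insert [Fintype ι] [AddCommMonoid F] {i m : κ} {L : Finset κ} (hi : i < m) (hm : m ∉ L)
    (J : Finset ι) (w : (ι → κ) → F) :
    ∑ f ∈ levelMaps i (insert m L) J, w f = ∑ I ∈ J.powerset, ∑ f ∈ levelMaps i L (J \ I),
      w (fun a => if a ∈ I then m else f a) := by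
  rw [Finset.sum_sigma']
  refine Finset.sum_bij' (fun f _ => ⟨J.filter (f · = m), fun a => if f a = m then i else f a⟩)
    (fun q _ => fun a => if a ∈ q.1 then m else q.2 a) ?_ ?_ ?_ ?_ ?_
  · intro f hf
    rw [mem_levelMaps] at hf
    simp only [mem_sigma, mem_powerset, filter_subset, true_and, mem_levelMaps]
    grind
  · rintro ⟨I, f⟩ hf
    simp only [mem_sigma, mem_powerset, mem_levelMaps] at hf ⊢
    grind
  · intro f hf
    rw [mem_levelMaps] at hf
    funext a
    simp only [mem_filter]
    grind
  · rintro ⟨I, f⟩ hf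
    simp only [mem_sigma, mem_powerset, mem_levelMaps] at hf
    have h1 : J.filter (fun a => (if a ∈ I then m else f a) = m) = I := by
      ext a
      simp only [mem_filter]
      grind
    have h2 : (fun a => if (if a ∈ I then m else f a) = m then i else
        (if a ∈ I then m else f a)) = f := by
      funext a
      grind
    simp only [h1, h2]
  · intro f hf
    congr 1
    rw [mem_levelMaps] at hf
    funext a
    simp only [mem_filter]
    grind

variable [Field F]

/-- The top level contributes a term of `splitSum`, apart from its sign. -/
theorem levelFactor_top (h : ι → ι → F) (t : ι → F) (e x y : κ → F) (z eta : F)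
    {J I : Finset ι} (hI : I ⊆ J) {f : ι → κ} {m : κ} (hf : ∀ a ∈ J \ I, f a < m) :
    levelFactor h t e x y z eta J (fun a => if a ∈ I then m else f a) m =
      (∏ s ∈ range #I, (e m * x m - eta ^ s * y m)) *
      (∏ s ∈ range #(J \ I), (e m * eta ^ s * z - y m)) * (∏ a ∈ I, (t a - z)) *
      (∏ b ∈ J \ I, (t b - x m)) * ∏ a ∈ I, ∏ b ∈ J \ I, h a b := by
  simp only [mem_sdiff] at hf
  have h1 : {a ∈ J | (if a ∈ I then m else f a) = m} = I := by
    ext a; simp only [mem_filter]; grind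
  have h2 : {a ∈ J | (if a ∈ I then m else f a) < m} = J \ I := by
    ext a; simp only [mem_filter, mem_sdiff]; grind
  have h3 : {a ∈ J | m < (if a ∈ I then m else f a)} = ∅ := by
    ext a; simp only [mem_filter, notMem_empty]; grind
  have h4 : {a ∈ J | (if a ∈ I then m else f a) ≤ m} = J := by
    ext a; simp only [mem_filter]; grind
  simp only [levelFactor, h1, h2, h3, h4, prod_empty, mul_one, Ico_self]

/-- Adding the fibre `I` over a higher level `m` completes, at each lower level, two partial products
to products over `J` and over `range #J`. -/
theorem levelFactor_below (h : ι → ι → F) (t : ι → F) (e x y : κ → F) (z eta : F)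
    {J I : Finset ι} (hI : I ⊆ J) {f : ι → κ} {m k : κ} (hk : k < m) :
    levelFactor h t e x y z eta J (fun a => if a ∈ I then m else f a) k =
      levelFactor h t e x y z eta (J \ I) f k * ((∏ a ∈ I, (e k * t a - y k)) *
        ∏ s ∈ Ico #(J \ I) #J, (eta ^ s * z - x k)) := by
  have h1 : {a ∈ J | (if a ∈ I then m else f a) = k} = {a ∈ J \ I | f a = k} := by
    ext a; simp only [mem_filter, mem_sdiff]; grind
  have h2 : {a ∈ J | (if a ∈ I then m else f a) < k} = {a ∈ J \ I | f a < k} := by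
    ext a; simp only [mem_filter, mem_sdiff]; grind
  have h3 : {a ∈ J | k < (if a ∈ I then m else f a)} = I ∪ {a ∈ J \ I | k < f a} := by
    ext a; simp only [mem_filter, mem_sdiff, mem_union]; grind
  have h4 : {a ∈ J | (if a ∈ I then m else f a) ≤ k} = {a ∈ J \ I | f a ≤ k} := by
    ext a; simp only [mem_filter, mem_sdiff]; grind
  have hd : Disjoint I {a ∈ J \ I | k < f a} :=
    disjoint_sdiff.mono_right (filter_subset _ _)
  rw [levelFactor, levelFactor, h1, h2, h3, h4, prod_union hd,
    ← prod_Ico_consecutive (fun s => eta ^ s * z - x k)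
      (card_le_card (filter_subset (fun a => f a ≤ k) (J \ I))) (card_le_card sdiff_subset)]
  ring

/-- Summing the weights of all maps into the levels `insert i L` merges the levels of `L` into the
bottom level `i` one at a time, each by `splitSum_eq`. -/
theorem sum_levelMaps_eq [Fintype ι] (t : ι → F) (e x y : κ → F) (z eta : F) (i : κ) (L : Finset κ)
    (hL : ∀ k ∈ L, i < k) (J : Finset ι) (ht : Set.InjOn t J) :
    ∑ f ∈ levelMaps i L J, (-1) ^ #{a ∈ J | f a = i} * ∏ k ∈ L,
        levelFactor (fun a b => (t a - eta * t b) / (t a - t b)) t e x y z eta J f k =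
      (-1) ^ #J * ∏ k ∈ L, ((∏ a ∈ J, (e k * t a - y k)) *
        ∏ s ∈ range #J, (eta ^ s * z - x k)) := by
  induction L using Finset.induction_on_max generalizing J with
  | empty =>
    have : levelMaps i ∅ J = {fun _ => i} := by
      ext f
      simp only [mem_levelMaps, notMem_empty, or_false, mem_singleton, funext_iff]
      exact ⟨fun hf a => if ha : a ∈ J then hf.1 a ha else hf.2 a ha, fun hf => by simp [hf]⟩
    simp [this]
  | insert m L hm ih =>
    have hmL : m ∉ L := fun hmem => lt_irrefl m (hm m hmem)
    have him : i < m := hL m (mem_insert_self m L)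
    have hL' : ∀ k ∈ L, i < k := fun k hk => hL k (mem_insert_of_mem hk)
    set h : ι → ι → F := fun a b => (t a - eta * t b) / (t a - t b) with hh
    set Q : F := ∏ k ∈ L, ((∏ a ∈ J, (e k * t a - y k)) * ∏ s ∈ range #J, (eta ^ s * z - x k))
      with hQ
    rw [sum_levelMaps_insert him hmL, prod_insert hmL]
    have step : ∀ I ∈ J.powerset, ∑ f ∈ levelMaps i L (J \ I),
        (-1) ^ #{a ∈ J | (if a ∈ I then m else f a) = i} * ∏ k ∈ insert m L,
          levelFactor h t e x y z eta J (fun a => if a ∈ I then m else f a) k =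
        ((-1) ^ #(J \ I) * (∏ s ∈ range #I, (e m * x m - eta ^ s * y m)) *
          (∏ s ∈ range #(J \ I), (e m * eta ^ s * z - y m)) * (∏ a ∈ I, (t a - z)) *
          (∏ b ∈ J \ I, (t b - x m)) * ∏ a ∈ I, ∏ b ∈ J \ I, h a b) * Q := by
      intro I hI
      rw [mem_powerset] at hI
      have hQI : Q = (∏ k ∈ L, ((∏ a ∈ I, (e k * t a - y k)) *
            ∏ s ∈ Ico #(J \ I) #J, (eta ^ s * z - x k))) *
          ∏ k ∈ L, ((∏ a ∈ J \ I, (e k * t a - y k)) *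
            ∏ s ∈ range #(J \ I), (eta ^ s * z - x k)) := by
        rw [hQ, ← prod_mul_distrib]
        refine prod_congr rfl fun k _ => ?_
        rw [← prod_sdiff hI, ← prod_range_mul_prod_Ico (fun s => eta ^ s * z - x k)
          (card_le_card (sdiff_subset (s := J) (t := I)))]
        ring
      have hsum := ih hL' (J \ I) (ht.mono (by simp))
      rw [hQI]
      calc _ = ∑ f ∈ levelMaps i L (J \ I),
            (((∏ s ∈ range #I, (e m * x m - eta ^ s * y m)) *
              (∏ s ∈ range #(J \ I), (e m * eta ^ s * z - y m)) * (∏ a ∈ I, (t a - z)) *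
              (∏ b ∈ J \ I, (t b - x m)) * ∏ a ∈ I, ∏ b ∈ J \ I, h a b) *
            ∏ k ∈ L, ((∏ a ∈ I, (e k * t a - y k)) *
              ∏ s ∈ Ico #(J \ I) #J, (eta ^ s * z - x k))) *
            ((-1) ^ #{a ∈ J \ I | f a = i} * ∏ k ∈ L,
              levelFactor h t e x y z eta (J \ I) f k) := by
            refine sum_congr rfl fun f hf => ?_
            rw [mem_levelMaps] at hf
            have hi : {a ∈ J | (if a ∈ I then m else f a) = i} = {a ∈ J \ I | f a = i} := by
              ext a; simp only [mem_filter, mem_sdiff]; grind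
            rw [hi, prod_insert hmL, levelFactor_top h t e x y z eta hI
              (fun a ha => (hf.1 a ha).elim (fun h => h ▸ him) (hm _)),
              prod_congr rfl fun k hk => levelFactor_below h t e x y z eta hI (hm k hk),
              prod_mul_distrib]
            ring
        _ = _ := by
            rw [← mul_sum, hsum]
            ring
    rw [sum_congr rfl step, ← sum_mul]
    have hs := splitSum_eq t (e m) (x m) (y m) z eta J ht
    rw [splitSum, splitProd] at hs
    rw [hs]
    ring

end Levels

end JingId

/-! ### Symmetrization over permutations -/

namespace JingId

/-- Partial fractions for `∏ (u - η v) / (u * ∏ (u - v))`. -/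
theorem sum_prod_erase_div {F : Type*} [Field F] [DecidableEq F] (eta : F) (heta : eta ≠ 1)
    (T : Finset F) :
    ∑ u ∈ T, ∏ v ∈ T.erase u, (u - eta * v) / (u - v) = (1 - eta ^ #T) / (1 - eta) := by
  have h1 : (1 : F) - eta ≠ 0 := sub_ne_zero.2 (Ne.symm heta)
  have key : ∀ T : Finset F, 0 ∉ T →
      ∑ u ∈ T, ∏ v ∈ T.erase u, (u - eta * v) / (u - v) = (1 - eta ^ #T) / (1 - eta) := by
    intro T h0
    have hmonic : (∏ v ∈ T, (Polynomial.X - Polynomial.C (eta * v))).Monic :=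
      Polynomial.monic_prod_of_monic _ _ fun v _ => Polynomial.monic_X_sub_C _
    have hl := Lagrange.leadingCoeff_eq_sum (s := insert 0 T) (v := id)
      (P := ∏ v ∈ T, (Polynomial.X - Polynomial.C (eta * v))) Function.injective_id.injOn (by
        rw [card_insert_of_notMem h0, Polynomial.degree_prod,
          sum_congr rfl fun v _ => Polynomial.degree_X_sub_C _]
        simp)
    rw [hmonic.leadingCoeff, sum_insert h0, erase_insert h0] at hl
    simp only [id, Polynomial.eval_prod, Polynomial.eval_sub, Polynomial.eval_X,
      Polynomial.eval_C] at hl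
    have hz : (∏ v ∈ T, (0 - eta * v)) / ∏ v ∈ T, (0 - v) = eta ^ #T := by
      rw [← prod_div_distrib, ← prod_const]
      refine prod_congr rfl fun v hv => ?_
      have : v ≠ 0 := fun h => h0 (h ▸ hv)
      rw [zero_sub, zero_sub, neg_div_neg_eq, mul_div_assoc, div_self this, mul_one]
    have hs : ∑ u ∈ T, (∏ v ∈ T, (u - eta * v)) / ∏ v ∈ (insert 0 T).erase u, (u - v) =
        (1 - eta) * ∑ u ∈ T, ∏ v ∈ T.erase u, (u - eta * v) / (u - v) := by
      rw [mul_sum]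
      refine sum_congr rfl fun u hu => ?_
      have hu0 : u ≠ 0 := fun h => h0 (h ▸ hu)
      rw [erase_insert_of_ne hu0.symm, prod_insert (fun h => h0 (mem_of_mem_erase h)),
        ← mul_prod_erase T _ hu, prod_div_distrib]
      rw [sub_zero, ← one_sub_mul, mul_comm (1 - eta) u, mul_assoc,
        mul_div_mul_left _ _ hu0, mul_div_assoc]
    rw [hz, hs] at hl
    rw [eq_div_iff h1]
    linear_combination -hl
  by_cases h0 : (0 : F) ∈ T
  · obtain ⟨S, hS, rfl⟩ : ∃ S, (0 : F) ∉ S ∧ insert 0 S = T :=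
      ⟨T.erase 0, by simp, insert_erase h0⟩
    have hz : ∏ v ∈ S, (0 - eta * v) / (0 - v) = eta ^ #S := by
      rw [← prod_const]
      refine prod_congr rfl fun v hv => ?_
      have : v ≠ 0 := fun h => hS (h ▸ hv)
      rw [zero_sub, zero_sub, neg_div_neg_eq, mul_div_assoc, div_self this, mul_one]
    have hs : ∑ u ∈ S, ∏ v ∈ (insert 0 S).erase u, (u - eta * v) / (u - v) =
        ∑ u ∈ S, ∏ v ∈ S.erase u, (u - eta * v) / (u - v) := by
      refine sum_congr rfl fun u hu => ?_
      have hu0 : u ≠ 0 := fun h => hS (h ▸ hu)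
      rw [erase_insert_of_ne hu0.symm, prod_insert (fun h => hS (mem_of_mem_erase h))]
      simp [hu0]
    rw [sum_insert hS, erase_insert hS, hz, hs, key S hS, card_insert_of_notMem hS]
    field_simp
    ring
  · exact key T h0

/-- The one-point symmetrization identity. -/
theorem sum_prod_pair {ι F : Type*} [DecidableEq ι] [Field F] (t : ι → F) (eta : F)
    (heta : eta ≠ 1) (S : Finset ι) (ht : Set.InjOn t S) :
    ∑ p ∈ S, ∏ q ∈ S.erase p, (t p - eta * t q) / (t p - t q) =
      (1 - eta ^ #S) / (1 - eta) := by
  classical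
  rw [← card_image_of_injOn ht, ← sum_prod_erase_div eta heta, sum_image ht]
  refine sum_congr rfl fun p hp => ?_
  have : (S.image t).erase (t p) = (S.erase p).image t := by
    ext v
    simp only [mem_erase, mem_image]
    constructor
    · rintro ⟨hv, q, hq, rfl⟩
      exact ⟨q, ⟨fun h => hv (h ▸ rfl), hq⟩, rfl⟩
    · rintro ⟨q, ⟨hqp, hq⟩, rfl⟩
      exact ⟨fun h => hqp (ht hq hp h), q, hq, rfl⟩
  rw [this, prod_image (ht.mono (by simp))]

@[to_additive]
theorem prod_univ_swap_succ {M : Type*} [CommMonoid M] {l : ℕ} (p : Fin (l + 1))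
    (w : Fin (l + 1) → M) : ∏ q, w q = w p * ∏ b : Fin l, w (Equiv.swap 0 p b.succ) := by
  rw [← Equiv.prod_comp (Equiv.swap 0 p) w, Fin.prod_univ_succ, Equiv.swap_apply_left]

theorem antitone_comp_decomposeFin {κ : Type*} [Preorder κ] {l : ℕ} (f : Fin (l + 1) → κ)
    (p : Fin (l + 1)) (e : Equiv.Perm (Fin l)) :
    Antitone (f ∘ Equiv.Perm.decomposeFin.symm (p, e)) ↔
      (∀ q, f q ≤ f p) ∧ Antitone ((fun b : Fin l => f (Equiv.swap 0 p b.succ)) ∘ e) := by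
  constructor
  · intro h
    refine ⟨fun q => ?_, fun a b hab => ?_⟩
    · obtain ⟨c, rfl⟩ := (Equiv.Perm.decomposeFin.symm (p, e)).surjective q
      simpa using h (Fin.zero_le c)
    · simpa using h (Fin.succ_le_succ_iff.2 hab)
  · rintro ⟨h1, h2⟩ a b hab
    induction a using Fin.cases with
    | zero => simpa using h1 _
    | succ a =>
      induction b using Fin.cases with
      | zero => simp at hab
      | succ b => simpa using h2 (Fin.succ_le_succ_iff.1 hab)

/-- The permutations sorting `f` symmetrize, inside each fibre of `f`, the pair factors to a
`η`-factorial. The induction peels off the first position, which receives an element `p` of the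
top fibre. -/
theorem sum_perm_antitone {κ F : Type*} [LinearOrder κ] [Fintype κ] [Field F] {l : ℕ}
    (f : Fin l → κ) (t : Fin l → F) (ht : Function.Injective t) (eta : F)
    (heta : ∀ s ∈ Icc 1 l, eta ^ s ≠ 1) :
    (∑ σ : Equiv.Perm (Fin l), open Classical in if Antitone (f ∘ σ) then
      ∏ a, ∏ b ∈ Ioi a, (t (σ a) - eta * t (σ b)) / (t (σ a) - t (σ b)) else 0) =
    (∏ m : κ, ∏ s ∈ Icc 1 #{a | f a = m}, (1 - eta ^ s) / (1 - eta)) *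
      ∏ p, ∏ q, if f q < f p then (t p - eta * t q) / (t p - t q) else 1 := by
  classical
  induction l with
  | zero => simp [Subsingleton.antitone]
  | succ l ih =>
    have heta1 : eta ≠ 1 := by simpa using heta 1 (by simp)
    have h1 : (1 : F) - eta ≠ 0 := sub_ne_zero.2 (Ne.symm heta1)
    set h : Fin (l + 1) → Fin (l + 1) → F := fun a b => (t a - eta * t b) / (t a - t b) with hh
    set T : Finset (Fin (l + 1)) := {p | ∀ q, f q ≤ f p} with hT
    obtain ⟨p₀, -, hp₀⟩ := exists_max_image univ f univ_nonempty
    have hTpos : 0 < #T := card_pos.2 ⟨p₀, by simpa [hT] using hp₀⟩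
    have hTle : #T ≤ l + 1 := by simpa using card_le_univ T
    set c : F := (1 - eta ^ #T) / (1 - eta) with hc
    have hc0 : c ≠ 0 := div_ne_zero
      (sub_ne_zero.2 (Ne.symm (heta _ (mem_Icc.2 ⟨hTpos, hTle⟩)))) h1
    set R : F := (∏ m : κ, ∏ s ∈ Icc 1 #{a | f a = m}, (1 - eta ^ s) / (1 - eta)) *
      ∏ p, ∏ q, if f q < f p then h p q else 1 with hR
    rw [← Equiv.sum_comp Equiv.Perm.decomposeFin.symm, Fintype.sum_prod_type]
    have step : ∀ p, (∑ e : Equiv.Perm (Fin l),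
        if Antitone (f ∘ Equiv.Perm.decomposeFin.symm (p, e)) then
          ∏ a, ∏ b ∈ Ioi a, h (Equiv.Perm.decomposeFin.symm (p, e) a)
            (Equiv.Perm.decomposeFin.symm (p, e) b) else 0) =
        if p ∈ T then (∏ q ∈ T.erase p, h p q) * (R / c) else 0 := by
      intro p
      simp only [antitone_comp_decomposeFin, Fin.prod_univ_succ, Fin.prod_Ioi_zero,
        Fin.prod_Ioi_succ, Equiv.Perm.decomposeFin_symm_apply_zero,
        Equiv.Perm.decomposeFin_symm_apply_succ]
      by_cases hp : p ∈ T
      swap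
      · have hp' : ¬ ∀ q, f q ≤ f p := by simpa [hT] using hp
        simp [hp, hp']
      have hp' : ∀ q, f q ≤ f p := by simpa [hT] using hp
      have hTp : ∀ q, q ∈ T ↔ f q = f p := by
        intro q
        simp only [hT, mem_filter_univ]
        exact ⟨fun hq => (hp' q).antisymm (hq p), fun hq r => hq ▸ hp' r⟩
      simp only [hp, hp', implies_true, true_and, if_true]
      set f' : Fin l → κ := fun b => f (Equiv.swap 0 p b.succ) with hf'
      set t' : Fin l → F := fun b => t (Equiv.swap 0 p b.succ) with ht'
      have ht'inj : Function.Injective t' :=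
        ht.comp ((Equiv.swap 0 p).injective.comp (Fin.succ_injective l))
      have ih' := ih f' t' ht'inj
        (fun s hs => heta s (by simp only [mem_Icc] at hs ⊢; omega))
      have e1 : ∀ e : Equiv.Perm (Fin l),
          ∏ b, h p (Equiv.swap 0 p (e b).succ) = ∏ b : Fin l, h p (Equiv.swap 0 p b.succ) :=
        fun e => Equiv.prod_comp e fun b => h p (Equiv.swap 0 p b.succ)
      simp only [e1, ← mul_ite_zero, ← mul_sum]
      refine (congrArg _ ih').trans ?_
      -- the factorials for `f` and `f'` differ by the factor `c`
      have hfact : ∏ m : κ, ∏ s ∈ Icc 1 #{a | f a = m}, (1 - eta ^ s) / (1 - eta) =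
          c * ∏ m : κ, ∏ s ∈ Icc 1 #{a | f' a = m}, (1 - eta ^ s) / (1 - eta) := by
        have hcard : ∀ m, #{a | f a = m} = (if f p = m then 1 else 0) + #{a | f' a = m} := by
          intro m
          simp only [card_filter]
          exact sum_univ_swap_succ p fun a => if f a = m then 1 else 0
        rw [← mul_prod_erase univ _ (mem_univ (f p)), ← mul_prod_erase univ _ (mem_univ (f p)),
          ← mul_assoc]
        congr 1
        · have hTc : #T = #{a | f' a = f p} + 1 := by
            have hTeq : T = ({a | f a = f p} : Finset _) := by ext q; simp [hTp]
            have := hcard (f p)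
            rw [if_pos rfl, ← hTeq] at this
            omega
          rw [hcard (f p), if_pos rfl, add_comm 1, prod_Icc_succ_top (by omega), hc, hTc, mul_comm]
        · refine prod_congr rfl fun m hm => ?_
          rw [hcard m, if_neg (Ne.symm (ne_of_mem_erase hm)), zero_add]
      have hpair : (∏ q, ∏ r, if f r < f q then h q r else 1) =
          (∏ b : Fin l, if f' b < f p then h p (Equiv.swap 0 p b.succ) else 1) *
          ∏ a, ∏ b, if f' b < f' a then (t' a - eta * t' b) / (t' a - t' b) else 1 := by
        rw [prod_univ_swap_succ p]
        congr 1
        · rw [prod_univ_swap_succ p]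
          simp [hf']
        · refine prod_congr rfl fun a _ => ?_
          rw [prod_univ_swap_succ p, if_neg (hp' _).not_gt, one_mul]
      have hrow : ∏ b : Fin l, h p (Equiv.swap 0 p b.succ) =
          (∏ q ∈ T.erase p, h p q) *
            ∏ b : Fin l, if f' b < f p then h p (Equiv.swap 0 p b.succ) else 1 := by
        have e2 : ∏ q ∈ T.erase p, h p q =
            ∏ b : Fin l, if f' b = f p then h p (Equiv.swap 0 p b.succ) else 1 := by
          have e3 := prod_univ_swap_succ p fun q => if q ∈ T.erase p then h p q else 1
          rw [prod_ite_mem, univ_inter] at e3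
          rw [e3]
          simp only [mem_erase, ne_eq, not_true_eq_false, false_and, if_false, one_mul, hTp]
          refine prod_congr rfl fun b _ => ?_
          have : Equiv.swap 0 p b.succ ≠ p := by
            intro hb
            rw [Equiv.swap_apply_eq_iff, Equiv.swap_apply_right] at hb
            exact Fin.succ_ne_zero b hb
          simp [this, hf']
        rw [e2, ← prod_mul_distrib]
        refine prod_congr rfl fun b _ => ?_
        rcases (hp' (Equiv.swap 0 p b.succ)).lt_or_eq with hlt | heq
        · simp [hf', hlt, hlt.ne]
        · simp [hf', heq]
      rw [hR, hfact, hpair, hrow]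
      field_simp
    rw [sum_congr rfl fun p _ => step p, sum_ite_mem, univ_inter, ← sum_mul,
      sum_prod_pair t eta heta1 T ht.injOn, ← hc]
    field_simp

end JingId

/-! ### The linear relation over a field -/

namespace JingId

/-- The weakly decreasing rearrangement of `f`. -/
def sortDesc {l : ℕ} {κ : Type*} [LinearOrder κ] (f : Fin l → κ) : Fin l → κ :=
  f ∘ Tuple.sort (OrderDual.toDual ∘ f)

theorem sortDesc_antitone {l : ℕ} {κ : Type*} [LinearOrder κ] (f : Fin l → κ) :
    Antitone (sortDesc f) :=
  fun _ _ hab => Tuple.monotone_sort (OrderDual.toDual ∘ f) hab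

theorem comp_perm_eq_sortDesc {l : ℕ} {κ : Type*} [LinearOrder κ] (f : Fin l → κ)
    (σ : Equiv.Perm (Fin l)) (h : Antitone (f ∘ σ)) : f ∘ σ = sortDesc f :=
  Tuple.unique_antitone h (sortDesc_antitone f)

theorem sortDesc_comp_perm {l : ℕ} {κ : Type*} [LinearOrder κ] (f : Fin l → κ)
    (σ : Equiv.Perm (Fin l)) : sortDesc (f ∘ σ) = sortDesc f :=
  comp_perm_eq_sortDesc f (σ * Tuple.sort (OrderDual.toDual ∘ (f ∘ σ)))
    (sortDesc_antitone (f ∘ σ))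

theorem card_filter_sortDesc {l : ℕ} {κ : Type*} [LinearOrder κ] (f : Fin l → κ) (P : κ → Prop)
    [DecidablePred P] : #{a | P (sortDesc f a)} = #{a | P (f a)} := by
  simp only [card_filter]
  exact Equiv.sum_comp (Tuple.sort (OrderDual.toDual ∘ f)) fun a => if P (f a) then 1 else 0

theorem mem_partitions {l n : ℕ} {lam : Fin l → Fin n} : lam ∈ partitions l n ↔ Antitone lam := by
  simp only [partitions, mem_filter_univ]
  exact Iff.rfl

theorem mem_partitionsBetween {l n : ℕ} {i j : Fin n} {lam : Fin l → Fin n} :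
    lam ∈ partitionsBetween l i j ↔ Antitone lam ∧ ∀ a, i ≤ lam a ∧ lam a ≤ j := by
  rw [partitionsBetween, mem_filter, mem_partitions]

/-- The pairs of different levels of `f` contribute a factor each. -/
def pairProd {l : ℕ} {κ F : Type*} [LinearOrder κ] [Field F] (f : Fin l → κ) (t : Fin l → F)
    (eta : F) : F :=
  ∏ p, ∏ q, if f q < f p then (t p - eta * t q) / (t p - t q) else 1

/-- The normalized sum over permutations in `PFormula`, for arbitrary weights `g`, is a sum over
the rearrangements of `lam`. The factor `r lam` cancels the symmetrization inside the fibres. -/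
theorem r_mul_sum_perm {F : Type*} [Field F] {l n : ℕ} {lam : Fin l → Fin n} (hlam : Antitone lam)
    (g : Fin l → Fin n → F) (t : Fin l → F) (ht : Function.Injective t) (eta : F)
    (heta : ∀ s ∈ Icc 1 l, eta ^ s ≠ 1) :
    r lam eta * ∑ σ : Equiv.Perm (Fin l), (∏ a, g (σ a) (lam a)) *
      ∏ a, ∏ b ∈ Ioi a, (t (σ a) - eta * t (σ b)) / (t (σ a) - t (σ b)) =
    ∑ f with sortDesc f = lam, (∏ p, g p (f p)) * pairProd f t eta := by
  classical
  set H : Equiv.Perm (Fin l) → F := fun σ =>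
    ∏ a, ∏ b ∈ Ioi a, (t (σ a) - eta * t (σ b)) / (t (σ a) - t (σ b)) with hH
  have e1 : ∀ σ : Equiv.Perm (Fin l), (∏ a, g (σ a) (lam a)) * H σ =
      ∑ f : Fin l → Fin n, if f ∘ σ = lam then (∏ p, g p (f p)) * H σ else 0 := by
    intro σ
    rw [sum_eq_single (lam ∘ σ.symm)]
    · have : (lam ∘ σ.symm) ∘ σ = lam := by
        funext a
        simp
      rw [if_pos this, ← Equiv.prod_comp σ fun p => g p ((lam ∘ σ.symm) p)]
      simp
    · intro f _ hf
      refine if_neg fun h => hf ?_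
      rw [← h]
      funext a
      simp
    · simp
  rw [sum_congr rfl fun σ _ => e1 σ, sum_comm, mul_sum, sum_filter]
  refine sum_congr rfl fun f _ => ?_
  by_cases hf : sortDesc f = lam
  · have e2 : ∀ σ : Equiv.Perm (Fin l), f ∘ σ = lam ↔ Antitone (f ∘ σ) := fun σ =>
      ⟨fun h => h ▸ hlam, fun h => (comp_perm_eq_sortDesc f σ h).trans hf⟩
    have e3 : r lam eta * ∏ m : Fin n, ∏ s ∈ Icc 1 #{a | f a = m}, (1 - eta ^ s) / (1 - eta) =
        1 := by
      rw [r, ← prod_mul_distrib]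
      refine prod_eq_one fun m _ => ?_
      have hm : mult m lam = #{a | f a = m} := by
        rw [mult, ← hf]
        exact card_filter_sortDesc f (· = m)
      rw [hm, ← prod_mul_distrib]
      refine prod_eq_one fun s hs => ?_
      have hc : #{a | f a = m} ≤ l := by simpa using card_le_univ ({a | f a = m} : Finset (Fin l))
      rw [mem_Icc] at hs
      have hs0 : 1 - eta ^ s ≠ 0 :=
        sub_ne_zero.2 (Ne.symm (heta s (mem_Icc.2 ⟨hs.1, hs.2.trans hc⟩)))
      have h10 : 1 - eta ≠ 0 := by
        have := heta 1 (mem_Icc.2 ⟨le_rfl, by omega⟩)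
        rw [pow_one] at this
        exact sub_ne_zero.2 (Ne.symm this)
      rw [div_mul_div_cancel₀ hs0, div_self h10]
    have e4 := sum_perm_antitone f t ht eta heta
    simp only [← e2] at e4
    simp only [← mul_ite_zero, ← mul_sum, if_pos hf]
    rw [hH, e4, pairProd]
    linear_combination (∏ p, g p (f p)) *
      (∏ p, ∏ q, if f q < f p then (t p - eta * t q) / (t p - t q) else 1) * e3
  · rw [if_neg hf, sum_eq_zero, mul_zero]
    intro σ _
    refine if_neg fun h => hf ?_
    rw [← comp_perm_eq_sortDesc f σ (h ▸ hlam), h]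

/-- An upper set of positions is described by the distance `l - 1 - a` to the last position. -/
theorem lt_card_of_antitone {l : ℕ} {P : Fin l → Prop} [DecidablePred P]
    (hP : ∀ a b, a ≤ b → P a → P b) (a : Fin l) : P a ↔ l - 1 - (a : ℕ) < #{b | P b} := by
  have ha := a.isLt
  constructor
  · intro h
    have : Ici a ⊆ ({b | P b} : Finset (Fin l)) := fun b hb => by
      simpa using hP a b (mem_Ici.1 hb) h
    have := card_le_card this
    rw [Fin.card_Ici] at this
    omega
  · intro h
    by_contra hn
    have : ({b | P b} : Finset (Fin l)) ⊆ Ioi a := fun b hb => by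
      rw [mem_Ioi]
      by_contra hba
      exact hn (hP b a (not_lt.1 hba) (by simpa using hb))
    have := card_le_card this
    rw [Fin.card_Ioi] at this
    omega

theorem prod_rev_filter {A : Type*} [CommMonoid A] {l : ℕ} (P : ℕ → Prop) [DecidablePred P]
    (g : ℕ → A) : ∏ a with P (l - 1 - (a : Fin l).val), g (l - 1 - (a : ℕ)) =
      ∏ s ∈ range l with P s, g s := by
  rw [prod_filter, prod_filter,
    Fin.prod_univ_eq_prod_range (fun a => if P (l - 1 - a) then g (l - 1 - a) else 1) l]
  exact prod_range_reflect (fun s => if P s then g s else 1) l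

theorem prod_filter_lt_of_antitone {A κ : Type*} [CommMonoid A] [LinearOrder κ] {l : ℕ}
    {lam : Fin l → κ} (hlam : Antitone lam) (k : κ) (g : ℕ → A) :
    ∏ a with lam a < k, g (l - 1 - (a : ℕ)) = ∏ s ∈ range #{a | lam a < k}, g s := by
  have h := lt_card_of_antitone (P := fun a => lam a < k) fun a b hab h => (hlam hab).trans_lt h
  have hle : #{a | lam a < k} ≤ l := by simpa using card_le_univ ({a | lam a < k} : Finset (Fin l))
  generalize #{a | lam a < k} = N at h hle ⊢
  rw [filter_congr fun a _ => h a, prod_rev_filter (· < N)]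
  congr 1
  ext s
  simp only [mem_filter, mem_range]
  omega

theorem prod_filter_gt_of_antitone {A κ : Type*} [CommMonoid A] [LinearOrder κ] {l : ℕ}
    {lam : Fin l → κ} (hlam : Antitone lam) (k : κ) (g : ℕ → A) :
    ∏ a with k < lam a, g (l - 1 - (a : ℕ)) = ∏ s ∈ Ico #{a | lam a ≤ k} l, g s := by
  have h := lt_card_of_antitone (P := fun a => lam a ≤ k) fun a b hab h => (hlam hab).trans h
  have h' : ∀ a, k < lam a ↔ ¬ (l - 1 - (a : ℕ) < #{b | lam b ≤ k}) := fun a => by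
    rw [← h a, not_le]
  rw [filter_congr fun a _ => h' a, prod_rev_filter (fun s => ¬ s < #{a | lam a ≤ k})]
  congr 1
  ext s
  simp only [mem_filter, mem_range, mem_Ico]
  omega

section Relation

variable {A : Type*} [CommRing A] {l n : ℕ}

/-- The polynomial `X_m(u; x; y) / u`. -/
def Xdiv (m : Fin n) (u : A) (x y : Fin n → A) : A :=
  (∏ k ∈ Iio m, (u - y k)) * ∏ k ∈ Ioi m, (u - x k)

theorem X_eq (m : Fin n) (u : A) (x y : Fin n → A) : X m u x y = u * Xdiv m u x y := by
  rw [X, Xdiv, mul_assoc]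

/-- The homogenized parameter `y`: the value at the top level `j` is `-1`. -/
def levelY (j : Fin n) (y : Fin n → A) (k : Fin n) : A := if k = j then -1 else y k

/-- The homogenizing parameter: it vanishes at the top level `j` only. -/
def levelE (j : Fin n) (k : Fin n) : A := if k = j then 0 else 1

/-- The exponents `l - 1 - a` at the positions `a` of parts below (above) `k` run through an initial
(final) segment of `range l`, so the coefficient depends on the multiplicities only and
splits into factors attached to the levels. -/
theorem c_eq_prod_levels {i j : Fin n} (hij : i < j) {lam : Fin l → Fin n} (hlam : Antitone lam)
    (hi : ∀ a, i ≤ lam a) (hj : ∀ a, lam a ≤ j) (x y : Fin n → A) (eta : A) :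
    c i j lam x y eta = (-1) ^ mult i lam * ∏ k ∈ Ioc i j,
      ((∏ s ∈ range #{a | lam a = k}, (levelE j k * x k - eta ^ s * levelY j y k)) *
        (∏ s ∈ range #{a | lam a < k}, (levelE j k * eta ^ s * y i - levelY j y k)) *
        ∏ s ∈ Ico #{a | lam a ≤ k} l, (eta ^ s * y i - x k)) := by
  have hins : Ioc i j = insert j (Ioo i j) := (Ioo_insert_right hij).symm
  rw [hins, prod_insert (by simp)]
  have htop : (∏ s ∈ range #{a | lam a = j}, (levelE j j * x j - eta ^ s * levelY j y j)) *
        (∏ s ∈ range #{a | lam a < j}, (levelE j j * eta ^ s * y i - levelY j y j)) *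
        ∏ s ∈ Ico #{a | lam a ≤ j} l, (eta ^ s * y i - x j) =
      eta ^ (mult j lam * (mult j lam - 1) / 2) := by
    have : #{a | lam a ≤ j} = l := by simp [hj]
    rw [this]
    simp only [levelE, levelY, if_true, zero_mul, zero_sub, mul_neg, mul_one, neg_neg, Ico_self,
      prod_empty, prod_const_one, mult]
    rw [prod_pow_eq_pow_sum _ (fun s => s), sum_range_id]
  have hmid : ∏ k ∈ Ioo i j,
      ((∏ s ∈ range #{a | lam a = k}, (levelE j k * x k - eta ^ s * levelY j y k)) *
        (∏ s ∈ range #{a | lam a < k}, (levelE j k * eta ^ s * y i - levelY j y k)) *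
        ∏ s ∈ Ico #{a | lam a ≤ k} l, (eta ^ s * y i - x k)) =
      ∏ k ∈ Ioo i j, ((∏ s ∈ range (mult k lam), (x k - eta ^ s * y k)) *
        (∏ a with lam a < k, (eta ^ (l - 1 - (a : ℕ)) * y i - y k)) *
        ∏ a with k < lam a, (eta ^ (l - 1 - (a : ℕ)) * y i - x k)) := by
    refine prod_congr rfl fun k hk => ?_
    have hkj : k ≠ j := (mem_Ioo.1 hk).2.ne
    rw [prod_filter_lt_of_antitone hlam k fun s => eta ^ s * y i - y k,
      prod_filter_gt_of_antitone hlam k fun s => eta ^ s * y i - x k]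
    simp [levelE, levelY, hkj, mult]
  have hx : ∏ a, ∏ k ∈ Ioo i (lam a), (eta ^ (l - 1 - (a : ℕ)) * y i - x k) =
      ∏ k ∈ Ioo i j, ∏ a with k < lam a, (eta ^ (l - 1 - (a : ℕ)) * y i - x k) := by
    refine prod_comm' fun a k => ?_
    simp only [mem_univ, mem_Ioo, true_and, mem_filter]
    exact ⟨fun h => ⟨h.2, h.1, h.2.trans_le (hj a)⟩, fun h => ⟨h.2.1, h.1⟩⟩
  rw [htop, hmid, prod_mul_distrib, prod_mul_distrib, c, prod_mul_distrib, hx]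
  have hy : ∏ a, ∏ m ∈ Ioo (lam a) j, (eta ^ (l - 1 - (a : ℕ)) * y i - y m) =
      ∏ k ∈ Ioo i j, ∏ a with lam a < k, (eta ^ (l - 1 - (a : ℕ)) * y i - y k) := by
    refine prod_comm' fun a k => ?_
    simp only [mem_univ, mem_Ioo, true_and, mem_filter]
    exact ⟨fun h => ⟨h.1, (hi a).trans_lt h.1, h.2⟩, fun h => ⟨h.1, h.2.2⟩⟩
  rw [hy]
  ring

theorem Xdiv_eq_prod_levels {i j m : Fin n} (him : i ≤ m) (hmj : m ≤ j) (u : A) (x y : Fin n → A) :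
    Xdiv m u x y = (∏ k ∈ Iio i, (u - y k)) * (∏ k ∈ Ioi j, (u - x k)) *
      ∏ k ∈ Ioc i j, ((if m = k then u - y i else 1) * (if m < k then u - x k else 1) *
        if k < m then levelE j k * u - levelY j y k else 1) := by
  have hy : ∏ k ∈ Iio m, (u - y k) = (∏ k ∈ Iio i, (u - y k)) * ∏ k ∈ Ico i m, (u - y k) := by
    rw [← prod_union (disjoint_left.2 fun k => by simp only [mem_Iio, mem_Ico]; omega)]
    congr 1
    ext k
    simp only [mem_Iio, mem_union, mem_Ico]
    omega
  have hx : ∏ k ∈ Ioi m, (u - x k) = (∏ k ∈ Ioi j, (u - x k)) * ∏ k ∈ Ioc m j, (u - x k) := by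
    rw [← prod_union (disjoint_left.2 fun k => by simp only [mem_Ioi, mem_Ioc]; omega)]
    congr 1
    ext k
    simp only [mem_Ioi, mem_union, mem_Ioc]
    omega
  have h2 : ∏ k ∈ Ioc i j, (if m < k then u - x k else 1) = ∏ k ∈ Ioc m j, (u - x k) := by
    rw [← prod_filter]
    congr 1
    ext k
    simp only [mem_filter, mem_Ioc]
    omega
  have h3 : ∏ k ∈ Ioc i j, (if k < m then levelE j k * u - levelY j y k else 1) =
      ∏ k ∈ Ioo i m, (u - y k) := by
    rw [← prod_filter]
    refine prod_congr ?_ fun k hk => ?_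
    · ext k
      simp only [mem_filter, mem_Ioc, mem_Ioo]
      omega
    · have : k ≠ j := ((mem_Ioo.1 hk).2.trans_le hmj).ne
      simp [levelE, levelY, this]
  have h1 : (∏ k ∈ Ioc i j, if m = k then u - y i else 1) * ∏ k ∈ Ioo i m, (u - y k) =
      ∏ k ∈ Ico i m, (u - y k) := by
    rw [prod_ite_eq]
    rcases him.lt_or_eq with hlt | rfl
    · rw [if_pos (mem_Ioc.2 ⟨hlt, hmj⟩), ← Ioo_insert_left hlt, prod_insert (by simp)]
    · simp
  rw [Xdiv, hy, hx, prod_mul_distrib, prod_mul_distrib, h2, h3, ← h1]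
  ring

end Relation

section Vanishing

variable {F : Type*} [Field F] {l n : ℕ}

theorem pairProd_eq_prod_levels {i j : Fin n} {f : Fin l → Fin n} (hf : ∀ a, i ≤ f a ∧ f a ≤ j)
    (t : Fin l → F) (eta : F) :
    pairProd f t eta = ∏ k ∈ Ioc i j, ∏ p with f p = k, ∏ q with f q < k,
      (t p - eta * t q) / (t p - t q) := by
  simp only [prod_filter]
  rw [pairProd, prod_comm]
  conv_rhs => rw [prod_comm]
  rw [prod_comm]
  refine prod_congr rfl fun p _ => ?_
  rw [prod_ite_eq]
  split_ifs with h
  · rfl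
  · have hfp : f p = i := by
      by_contra hne
      exact h (mem_Ioc.2 ⟨(hf p).1.lt_of_ne (Ne.symm hne), (hf p).2⟩)
    exact prod_eq_one fun q _ => if_neg (by rw [hfp]; exact (hf q).1.not_gt)

/-- The weight of `f` in the linear relation is a product over the levels above `i`. -/
theorem c_mul_weight_eq {i j : Fin n} (hij : i < j) {f : Fin l → Fin n}
    (hf : ∀ a, i ≤ f a ∧ f a ≤ j) (t : Fin l → F) (x y : Fin n → F) (eta : F) :
    c i j (sortDesc f) x y eta * ((∏ p, Xdiv (f p) (t p) x y) * pairProd f t eta) =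
      (∏ a, ((∏ k ∈ Iio i, (t a - y k)) * ∏ k ∈ Ioi j, (t a - x k))) *
      ((-1) ^ #{a | f a = i} * ∏ k ∈ Ioc i j,
        levelFactor (fun a b => (t a - eta * t b) / (t a - t b)) t (levelE j) x (levelY j y)
          (y i) eta univ f k) := by
  have hX : ∏ p, Xdiv (f p) (t p) x y =
      (∏ a, ((∏ k ∈ Iio i, (t a - y k)) * ∏ k ∈ Ioi j, (t a - x k))) *
      ∏ k ∈ Ioc i j, ((∏ a with f a = k, (t a - y i)) * (∏ a with f a < k, (t a - x k)) *
        ∏ a with k < f a, (levelE j k * t a - levelY j y k)) := by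
    simp only [prod_filter, ← prod_mul_distrib]
    rw [prod_comm, ← prod_mul_distrib]
    refine prod_congr rfl fun a _ => ?_
    exact Xdiv_eq_prod_levels (hf a).1 (hf a).2 (t a) x y
  rw [c_eq_prod_levels hij (sortDesc_antitone f) (fun a => (hf _).1) (fun a => (hf _).2), hX,
    pairProd_eq_prod_levels hf, mult, card_filter_sortDesc f (· = i)]
  have e1 := fun k => card_filter_sortDesc f (· = k)
  have e2 := fun k => card_filter_sortDesc f (· < k)
  have e3 := fun k => card_filter_sortDesc f (· ≤ k)
  simp only [e1, e2, e3, levelFactor, card_univ, Fintype.card_fin, prod_mul_distrib]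
  ring

/-- The linear relation over a field, with the factors `u` of the `X_m(u)` removed. -/
theorem sum_c_mul_symm_eq_zero (hl : 1 ≤ l) {i j : Fin n} (hij : i < j) (t : Fin l → F)
    (ht : Function.Injective t) (x y : Fin n → F) (eta : F) (heta : ∀ s ∈ Icc 1 l, eta ^ s ≠ 1)
    (hx : x j = eta ^ (l - 1) * y i) :
    ∑ lam ∈ partitionsBetween l i j, c i j lam x y eta * (r lam eta *
      ∑ σ : Equiv.Perm (Fin l), (∏ a, Xdiv (lam a) (t (σ a)) x y) *
        ∏ a, ∏ b ∈ Ioi a, (t (σ a) - eta * t (σ b)) / (t (σ a) - t (σ b))) = 0 := by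
  have hlev : ∀ f : Fin l → Fin n, f ∈ levelMaps i (Ioc i j) univ ↔ ∀ a, i ≤ f a ∧ f a ≤ j := by
    intro f
    simp only [mem_levelMaps, mem_univ, true_imp_iff, not_true_eq_false, false_imp_iff,
      implies_true, and_true, mem_Ioc]
    refine forall_congr' fun a => ?_
    omega
  calc _ = ∑ lam ∈ partitionsBetween l i j, ∑ f ∈ levelMaps i (Ioc i j) univ with
        sortDesc f = lam, c i j (sortDesc f) x y eta *
          ((∏ p, Xdiv (f p) (t p) x y) * pairProd f t eta) := by
        refine sum_congr rfl fun lam hlam => ?_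
        rw [mem_partitionsBetween] at hlam
        rw [r_mul_sum_perm hlam.1 (fun p m => Xdiv m (t p) x y) t ht eta heta, mul_sum]
        refine sum_congr ?_ fun f hf => by rw [(mem_filter.1 hf).2]
        ext f
        simp only [mem_filter, mem_univ, true_and, hlev]
        refine ⟨fun h => ⟨fun a => ?_, h⟩, fun h => h.2⟩
        have := hlam.2 ((Tuple.sort (OrderDual.toDual ∘ f)).symm a)
        rw [← h] at this
        simpa [sortDesc] using this
    _ = ∑ f ∈ levelMaps i (Ioc i j) univ, c i j (sortDesc f) x y eta *
          ((∏ p, Xdiv (f p) (t p) x y) * pairProd f t eta) := by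
        refine sum_fiberwise_of_maps_to (fun f hf => ?_) _
        rw [hlev] at hf
        exact mem_partitionsBetween.2 ⟨sortDesc_antitone f, fun a => hf _⟩
    _ = (∏ a, ((∏ k ∈ Iio i, (t a - y k)) * ∏ k ∈ Ioi j, (t a - x k))) *
          ∑ f ∈ levelMaps i (Ioc i j) univ, (-1) ^ #{a | f a = i} * ∏ k ∈ Ioc i j,
            levelFactor (fun a b => (t a - eta * t b) / (t a - t b)) t (levelE j) x (levelY j y)
              (y i) eta univ f k := by
        rw [mul_sum]
        exact sum_congr rfl fun f hf => c_mul_weight_eq hij ((hlev f).1 hf) t x y eta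
    _ = 0 := by
        rw [sum_levelMaps_eq t (levelE j) x (levelY j y) (y i) eta i (Ioc i j)
          (fun k hk => (mem_Ioc.1 hk).1) univ ht.injOn,
          prod_eq_zero (i := j) (mem_Ioc.2 ⟨hij, le_rfl⟩), mul_zero, mul_zero]
        -- the factor of the top level with `s = l - 1` is `η^{l-1} y_i - x_j`
        rw [prod_eq_zero (i := l - 1) (s := range _) (by simp; omega) (by rw [hx, sub_self]),
          mul_zero]

end Vanishing

end JingId

/-! ### Polynomiality, specialization, and Jing's identity -/

namespace JingId

section Numerator

variable {A : Type*} [CommRing A] {l n : ℕ}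

/-- The factor of the pair `a < b` in the numerator of `P_lam` over `∏_{a < b} (t_a - t_b)`. -/
def pairNum {κ : Type*} [LinearOrder κ] (f : Fin l → κ) (t : Fin l → A) (eta : A)
    (a b : Fin l) : A :=
  if f b < f a then t a - eta * t b else if f a < f b then eta * t a - t b else t a - t b

theorem pairNum_swap {κ : Type*} [LinearOrder κ] (f : Fin l → κ) (t : Fin l → A) (eta : A)
    (a b : Fin l) : pairNum f t eta a b = -pairNum f t eta b a := by
  rcases lt_trichotomy (f a) (f b) with h | h | h
  · simp [pairNum, h, h.not_gt]
  · simp [pairNum, h]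
  · simp [pairNum, h, h.not_gt]

/-- The numerator of `P_lam` over the common denominator `∏_{a < b} (t_a - t_b)`. -/
def numer (lam : Fin l → Fin n) (t : Fin l → A) (x y : Fin n → A) (eta : A) : A :=
  ∑ f with sortDesc f = lam, (∏ p, X (f p) (t p) x y) * ∏ a, ∏ b ∈ Ioi a, pairNum f t eta a b

theorem map_X {B : Type*} [CommRing B] (φ : A →+* B) (m : Fin n) (u : A) (x y : Fin n → A) :
    φ (X m u x y) = X m (φ u) (fun k => φ (x k)) (fun k => φ (y k)) := by
  simp [X, map_prod]

theorem map_numer {B : Type*} [CommRing B] (φ : A →+* B) (lam : Fin l → Fin n) (t : Fin l → A)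
    (x y : Fin n → A) (eta : A) : φ (numer lam t x y eta) =
      numer lam (fun a => φ (t a)) (fun k => φ (x k)) (fun k => φ (y k)) (φ eta) := by
  have : ∀ (f : Fin l → Fin n) a b, φ (pairNum f t eta a b) =
      pairNum f (fun a => φ (t a)) (φ eta) a b := by
    intro f a b
    unfold pairNum
    split_ifs <;> simp
  simp [numer, map_sum, map_prod, map_X, this]

theorem map_c {B : Type*} [CommRing B] (φ : A →+* B) (i j : Fin n) (lam : Fin l → Fin n)
    (x y : Fin n → A) (eta : A) : φ (c i j lam x y eta) =
      c i j lam (fun k => φ (x k)) (fun k => φ (y k)) (φ eta) := by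
  simp [c, map_prod]

/-- If `t a = t b`, the terms of `f` and of `f` with the values at `a` and `b` exchanged cancel. -/
theorem numer_eq_zero (lam : Fin l → Fin n) (t : Fin l → A) (x y : Fin n → A) (eta : A)
    {a b : Fin l} (hab : a < b) (ht : t a = t b) : numer lam t x y eta = 0 := by
  set τ := Equiv.swap a b with hτ
  have htτ : ∀ p, t (τ p) = t p := by
    intro p
    rw [hτ, Equiv.swap_apply_def]
    split_ifs with h1 h2
    · rw [h1, ht]
    · rw [h2, ht]
    · rfl
  refine sum_involution (fun f _ => f ∘ τ) ?_ ?_ ?_ ?_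
  · intro f _
    have h1 : ∏ p, X ((f ∘ τ) p) (t p) x y = ∏ p, X (f p) (t p) x y := by
      rw [← Equiv.prod_comp τ fun p => X (f p) (t p) x y]
      simp [htτ]
    have h2 : ∏ p, ∏ q ∈ Ioi p, pairNum (f ∘ τ) t eta p q =
        -∏ p, ∏ q ∈ Ioi p, pairNum f t eta p q := by
      have h3 : ∀ p q, pairNum (f ∘ τ) t eta p q = pairNum f t eta (τ p) (τ q) := by
        intro p q
        simp [pairNum, htτ]
      simp only [h3]
      rw [τ.prod_Ioi_comp_eq_sign_mul_prod (pairNum_swap f t eta), hτ,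
        Equiv.Perm.sign_swap hab.ne]
      simp
    rw [h1, h2]
    ring
  · intro f _ hf hfix
    apply hf
    have hfab : f a = f b := by
      have := congrFun hfix b
      simpa [hτ] using this
    have : pairNum f t eta a b = 0 := by simp [pairNum, hfab, ht]
    rw [prod_eq_zero (f := fun a => ∏ b ∈ Ioi a, pairNum f t eta a b) (mem_univ a)
      (prod_eq_zero (mem_Ioi.2 hab) this), mul_zero]
  · intro f hf
    rw [mem_filter_univ] at hf ⊢
    rw [sortDesc_comp_perm, hf]
  · intro f _
    funext p
    simp [hτ]

end Numerator

section Evaluation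

variable {F : Type*} [Field F] {l n : ℕ}

theorem pairProd_mul_prod_sub (f : Fin l → Fin n) (t : Fin l → F) (ht : Function.Injective t)
    (eta : F) : pairProd f t eta * ∏ a, ∏ b ∈ Ioi a, (t a - t b) =
      ∏ a, ∏ b ∈ Ioi a, pairNum f t eta a b := by
  set K : Fin l → Fin l → F := fun p q =>
    if f q < f p then (t p - eta * t q) / (t p - t q) else 1 with hK
  have h1 : pairProd f t eta = ∏ a, ∏ b ∈ Ioi a, K b a * K a b := by
    rw [prod_prod_Ioi_mul_eq_prod_prod_off_diag K, pairProd, prod_comm]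
    refine prod_congr rfl fun q _ => ?_
    rw [← mul_prod_erase univ _ (mem_univ q), ← compl_singleton]
    simp [hK]
  rw [h1, ← prod_mul_distrib]
  refine prod_congr rfl fun a _ => ?_
  rw [← prod_mul_distrib]
  refine prod_congr rfl fun b hb => ?_
  have hab : t a - t b ≠ 0 := sub_ne_zero.2 fun h => (mem_Ioi.1 hb).ne (ht h)
  have hba : t b - t a ≠ 0 := sub_ne_zero.2 fun h => (mem_Ioi.1 hb).ne' (ht h)
  rcases lt_trichotomy (f a) (f b) with h | h | h
  · simp only [hK, pairNum, h, h.not_gt, if_true, if_false]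
    field_simp
    ring
  · simp [hK, pairNum, h]
  · simp only [hK, pairNum, h, h.not_gt, if_true, if_false]
    field_simp

theorem prod_sub_ne_zero (t : Fin l → F) (ht : Function.Injective t) :
    ∏ a, ∏ b ∈ Ioi a, (t a - t b) ≠ 0 :=
  prod_ne_zero_iff.2 fun _ _ => prod_ne_zero_iff.2 fun _ hb =>
    sub_ne_zero.2 fun h => (mem_Ioi.1 hb).ne (ht h)

theorem PFormula_mul_prod_sub {lam : Fin l → Fin n} (hlam : Antitone lam) (t : Fin l → F)
    (ht : Function.Injective t) (x y : Fin n → F) (eta : F) (heta : ∀ s ∈ Icc 1 l, eta ^ s ≠ 1) :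
    PFormula lam t x y eta * ∏ a, ∏ b ∈ Ioi a, (t a - t b) = numer lam t x y eta := by
  rw [PFormula, r_mul_sum_perm hlam (fun p m => X m (t p) x y) t ht eta heta, numer, sum_mul]
  refine sum_congr rfl fun f _ => ?_
  rw [mul_assoc, pairProd_mul_prod_sub f t ht]

theorem PFormula_eq_prod_mul (lam : Fin l → Fin n) (t : Fin l → F) (x y : Fin n → F) (eta : F) :
    PFormula lam t x y eta = (∏ a, t a) * (r lam eta *
      ∑ σ : Equiv.Perm (Fin l), (∏ a, Xdiv (lam a) (t (σ a)) x y) *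
        ∏ a, ∏ b ∈ Ioi a, (t (σ a) - eta * t (σ b)) / (t (σ a) - t (σ b))) := by
  rw [PFormula, mul_left_comm, mul_sum (a := ∏ a, t a)]
  congr 1
  refine sum_congr rfl fun σ _ => ?_
  simp only [X_eq, prod_mul_distrib, Equiv.prod_comp σ t]
  ring

end Evaluation

section Polynomial

/-- The difference of two indeterminates divides the polynomials that vanish on identifying them. -/
theorem X_sub_X_dvd_iff {τ : Type*} [DecidableEq τ] (v w : τ) (p : MvPolynomial τ ℤ) :
    (MvPolynomial.X v - MvPolynomial.X w) ∣ p ↔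
      MvPolynomial.aeval (Function.update MvPolynomial.X v (MvPolynomial.X w) :
        τ → MvPolynomial τ ℤ) p = 0 := by
  set φ := MvPolynomial.aeval (R := ℤ) (Function.update MvPolynomial.X v (MvPolynomial.X w) :
    τ → MvPolynomial τ ℤ) with hφ
  constructor
  · rintro ⟨q, rfl⟩
    have : φ (MvPolynomial.X v - MvPolynomial.X w) = 0 := by
      by_cases h : w = v
      · simp [h]
      · simp [hφ, Function.update_of_ne h]
    rw [map_mul, this, zero_mul]
  · intro hp
    set I := Ideal.span {(MvPolynomial.X v - MvPolynomial.X w : MvPolynomial τ ℤ)}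
    have key : (Ideal.Quotient.mk I).comp φ.toRingHom = Ideal.Quotient.mk I := by
      refine MvPolynomial.ringHom_ext (fun m => by simp) fun u => ?_
      by_cases h : u = v
      · subst h
        simp only [RingHom.comp_apply, AlgHom.toRingHom_eq_coe, RingHom.coe_coe, hφ,
          MvPolynomial.aeval_X, Function.update_self]
        rw [eq_comm, Ideal.Quotient.eq]
        exact Ideal.mem_span_singleton_self _
      · simp [hφ, Function.update_of_ne h]
    rw [← Ideal.mem_span_singleton, ← Ideal.Quotient.eq_zero_iff_mem, ← key]
    simp [hp]

theorem prime_X_sub_X {τ : Type*} {v w : τ} (hvw : v ≠ w) :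
    Prime (MvPolynomial.X v - MvPolynomial.X w : MvPolynomial τ ℤ) := by
  classical
  refine ⟨sub_ne_zero.2 fun h => hvw (MvPolynomial.X_injective h), fun hu => ?_, fun p q h => ?_⟩
  · have := (X_sub_X_dvd_iff v w 1).1 hu.dvd
    simp at this
  · rw [X_sub_X_dvd_iff, map_mul, mul_eq_zero] at h
    rwa [X_sub_X_dvd_iff, X_sub_X_dvd_iff]

theorem isRelPrime_X_sub_X {τ : Type*} {v w v' w' : τ} (h : v ≠ w) (h' : v' ≠ w')
    (h1 : ¬ (v' = v ∧ w' = w)) (h2 : ¬ (v' = w ∧ w' = v)) :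
    IsRelPrime (MvPolynomial.X v - MvPolynomial.X w : MvPolynomial τ ℤ)
      (MvPolynomial.X v' - MvPolynomial.X w') := by
  classical
  rw [(prime_X_sub_X h).irreducible.isRelPrime_iff_not_dvd, X_sub_X_dvd_iff, map_sub,
    MvPolynomial.aeval_X, MvPolynomial.aeval_X, sub_eq_zero]
  have e : ∀ u, (Function.update MvPolynomial.X v (MvPolynomial.X w) : τ → MvPolynomial τ ℤ) u =
      MvPolynomial.X (if u = v then w else u) := by
    intro u
    rw [Function.update_apply]
    split_ifs <;> rfl
  rw [e, e]
  intro heq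
  have := MvPolynomial.X_injective heq
  grind

/-- The numerator in independent indeterminates is divisible by the denominator: it vanishes
wherever two of the `t_a` agree, and the `t_a - t_b` are pairwise non-associated primes. -/
theorem prod_sub_dvd_numer {l n : ℕ} (lam : Fin l → Fin n) :
    (∏ a : Fin l, ∏ b ∈ Ioi a, (MvPolynomial.X (.t a) - MvPolynomial.X (.t b) :
        MvPolynomial (Indet l n) ℤ)) ∣
      numer lam (fun a => MvPolynomial.X (.t a)) (fun m => MvPolynomial.X (.x m))
        (fun m => MvPolynomial.X (.y m)) (MvPolynomial.X .eta) := by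
  classical
  rw [prod_sigma']
  refine prod_dvd_of_isRelPrime ?_ ?_
  · rintro ⟨a, b⟩ hab ⟨a', b'⟩ hab' hne
    simp only [mem_coe, mem_sigma, mem_univ, true_and, mem_Ioi] at hab hab'
    refine isRelPrime_X_sub_X ?_ ?_ ?_ ?_
    all_goals
      simp only [Indet.t.injEq, ne_eq, Sigma.mk.injEq, heq_eq_eq] at hne ⊢
      grind
  · rintro ⟨a, b⟩ hab
    simp only [mem_sigma, mem_univ, true_and, mem_Ioi] at hab
    rw [X_sub_X_dvd_iff]
    rw [← RingHom.coe_coe (MvPolynomial.aeval _), map_numer]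
    refine numer_eq_zero lam _ _ _ _ hab ?_
    have hba : (Indet.t b : Indet l n) ≠ .t a := by simpa using hab.ne'
    simp [Function.update_of_ne hba]

/-- The polynomial `P_lam`. -/
noncomputable def PPoly {l n : ℕ} (lam : Fin l → Fin n) : MvPolynomial (Indet l n) ℤ :=
  (prod_sub_dvd_numer lam).choose

/-- Evaluation of polynomials at elements of a commutative ring. -/
noncomputable def evalAt {A : Type*} [CommRing A] {l n : ℕ} (t : Fin l → A) (x y : Fin n → A)
    (eta : A) : MvPolynomial (Indet l n) ℤ →+* A :=
  (MvPolynomial.aeval (R := ℤ) (Indet.assign t x y eta)).toRingHom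

theorem evalAt_PPoly {F : Type*} [Field F] {l n : ℕ} {lam : Fin l → Fin n} (hlam : Antitone lam)
    (t : Fin l → F) (ht : Function.Injective t) (x y : Fin n → F) (eta : F)
    (heta : ∀ s ∈ Icc 1 l, eta ^ s ≠ 1) :
    evalAt t x y eta (PPoly lam) = PFormula lam t x y eta := by
  have h := congrArg (MvPolynomial.aeval (R := ℤ) (Indet.assign t x y eta)).toRingHom
    (prod_sub_dvd_numer lam).choose_spec
  rw [map_numer] at h
  simp only [AlgHom.toRingHom_eq_coe, RingHom.coe_coe, map_mul, map_prod, map_sub,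
    MvPolynomial.aeval_X, Indet.assign] at h
  rw [← PFormula_mul_prod_sub hlam t ht x y eta heta, mul_comm] at h
  exact (mul_left_cancel₀ (prod_sub_ne_zero t ht) h).symm

theorem map_evalAt {A B : Type*} [CommRing A] [CommRing B] {l n : ℕ} (φ : A →+* B)
    (t : Fin l → A) (x y : Fin n → A) (eta : A) (p : MvPolynomial (Indet l n) ℤ) :
    φ (evalAt t x y eta p) =
      evalAt (fun a => φ (t a)) (fun m => φ (x m)) (fun m => φ (y m)) (φ eta) p := by
  rw [← RingHom.comp_apply]
  refine RingHom.congr_fun (MvPolynomial.ringHom_ext (fun m => by simp) fun v => ?_) p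
  cases v <;> simp [evalAt, Indet.assign]

/-- A ring homomorphism on polynomials is the evaluation at the images of the indeterminates. -/
theorem evalAt_ringHom {B : Type*} [CommRing B] {l n : ℕ}
    (φ : MvPolynomial (Indet l n) ℤ →+* B) (p : MvPolynomial (Indet l n) ℤ) :
    evalAt (fun a => φ (MvPolynomial.X (.t a))) (fun m => φ (MvPolynomial.X (.x m)))
      (fun m => φ (MvPolynomial.X (.y m))) (φ (MvPolynomial.X .eta)) p = φ p := by
  refine RingHom.congr_fun (MvPolynomial.ringHom_ext (fun m => by simp) fun v => ?_) p
  cases v <;> simp [evalAt, Indet.assign]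

theorem gen_injective {l n : ℕ} : Function.Injective (gen : Indet l n → RatField l n) :=
  (IsFractionRing.injective (MvPolynomial (Indet l n) ℤ) (RatField l n)).comp
    MvPolynomial.X_injective

theorem gen_pow_ne_one {l n : ℕ} (v : Indet l n) {s : ℕ} (hs : s ≠ 0) : gen v ^ s ≠ 1 := by
  intro h
  rw [gen, ← map_pow, ← map_one (algebraMap (MvPolynomial (Indet l n) ℤ) (RatField l n))] at h
  have h' := congrArg (MvPolynomial.aeval (R := ℤ) fun _ => (0 : ℤ))
    (IsFractionRing.injective (MvPolynomial (Indet l n) ℤ) (RatField l n) h)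
  simp [hs] at h'

theorem algebraMap_PPoly {l n : ℕ} {lam : Fin l → Fin n} (hlam : Antitone lam) :
    algebraMap (MvPolynomial (Indet l n) ℤ) (RatField l n) (PPoly lam) = PRat lam := by
  rw [PRat, ← evalAt_PPoly hlam _ (fun a b h => by simpa using gen_injective h) _ _ _
    fun s hs => gen_pow_ne_one _ (by have := (mem_Icc.1 hs).1; omega)]
  exact (evalAt_ringHom (algebraMap (MvPolynomial (Indet l n) ℤ) (RatField l n)) _).symm

/-- The linear relation for the polynomials `P_lam`. It is first proved for the indeterminates with
`x_j` replaced by `η^{l-1} y_i`, from which every admissible assignment factors. -/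
theorem sum_c_mul_PPoly {l n : ℕ} (hl : 1 ≤ l) {i j : Fin n} (hij : i < j) {A : Type*}
    [CommRing A] (t : Fin l → A) (x y : Fin n → A) (eta : A) (hx : x j = eta ^ (l - 1) * y i) :
    ∑ lam ∈ partitionsBetween l i j, c i j lam x y eta *
      MvPolynomial.aeval (Indet.assign t x y eta) (PPoly lam) = 0 := by
  let T : Fin l → MvPolynomial (Indet l n) ℤ := fun a => MvPolynomial.X (.t a)
  let Y : Fin n → MvPolynomial (Indet l n) ℤ := fun k => MvPolynomial.X (.y k)
  let E : MvPolynomial (Indet l n) ℤ := MvPolynomial.X .eta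
  let X' : Fin n → MvPolynomial (Indet l n) ℤ := fun k =>
    if k = j then E ^ (l - 1) * Y i else MvPolynomial.X (.x k)
  have huniv : ∑ lam ∈ partitionsBetween l i j, c i j lam X' Y E *
      evalAt T X' Y E (PPoly lam) = 0 := by
    set φ := algebraMap (MvPolynomial (Indet l n) ℤ) (RatField l n)
    apply IsFractionRing.injective (MvPolynomial (Indet l n) ℤ) (RatField l n)
    have ht : Function.Injective fun a => φ (T a) := fun a b h => by
      simpa using gen_injective (l := l) (n := n) h
    have heta : ∀ s ∈ Icc 1 l, φ E ^ s ≠ 1 := fun s hs =>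
      gen_pow_ne_one _ (by have := (mem_Icc.1 hs).1; omega)
    rw [map_sum, map_zero]
    have key := sum_c_mul_symm_eq_zero hl hij (fun a => φ (T a)) ht (fun k => φ (X' k))
      (fun k => φ (Y k)) (φ E) heta (by simp [X'])
    have key' := congrArg ((∏ a, φ (T a)) * ·) key
    simp only [mul_zero] at key'
    rw [← key', mul_sum]
    refine sum_congr rfl fun lam hlam => ?_
    rw [mem_partitionsBetween] at hlam
    rw [map_mul, map_c, map_evalAt, evalAt_PPoly hlam.1 _ ht _ _ _ heta,
      PFormula_eq_prod_mul, mul_left_comm]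
  set ψ := evalAt t x y eta with hψ
  have hT : ∀ a, ψ (T a) = t a := fun a => by simp [hψ, evalAt, T, Indet.assign]
  have hY : ∀ k, ψ (Y k) = y k := fun k => by simp [hψ, evalAt, Y, Indet.assign]
  have hE : ψ E = eta := by simp [hψ, evalAt, E, Indet.assign]
  have hX : ∀ k, ψ (X' k) = x k := fun k => by
    by_cases hk : k = j
    · simp [X', hk, hY, hE, hx]
    · simp [X', hk, hψ, evalAt, Indet.assign]
  have h := congrArg ψ huniv
  rw [map_sum, map_zero] at h
  rw [← h]
  refine sum_congr rfl fun lam _ => ?_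
  rw [map_mul, map_c, map_evalAt]
  simp only [hX, hY, hE, hT]
  rfl

end Polynomial

section Jing

variable {F : Type*} [Field F] {l : ℕ}

theorem prod_Icc_one_eq_range (f : ℕ → F) (k : ℕ) :
    ∏ s ∈ Icc 1 k, f s = ∏ s ∈ range k, f (s + 1) := by
  rw [range_eq_Ico, prod_Ico_add' f 0 k 1]
  rfl

/-- Comparison of the coefficients for the partition with `k` parts `2` and `m` parts `1`. -/
theorem jing_coeff (eta : F) (k m : ℕ) (heta : ∀ s ∈ Icc 1 (k + m), eta ^ s ≠ 1) :
    (-1) ^ m * eta ^ (k * (k - 1) / 2) * ((∏ s ∈ Icc 1 k, (1 - eta) / (1 - eta ^ s)) *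
      ∏ s ∈ Icc 1 m, (1 - eta) / (1 - eta ^ s)) =
    (-1) ^ (k + m) * (∏ s ∈ Icc 1 (k + m), (1 - eta) / (1 - eta ^ s)) *
      ∏ s ∈ range k, (eta ^ (k + m) - eta ^ s) / (1 - eta ^ (s + 1)) := by
  have h1 : ∏ s ∈ range k, (eta ^ (k + m) - eta ^ s) =
      (-1) ^ k * eta ^ (k * (k - 1) / 2) * ∏ s ∈ range k, (1 - eta ^ (m + s + 1)) := by
    rw [← prod_range_reflect fun s => 1 - eta ^ (m + s + 1), ← sum_range_id,
      ← prod_pow_eq_pow_sum, show (-1 : F) ^ k = ∏ _s ∈ range k, (-1) by simp,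
      ← prod_mul_distrib, ← prod_mul_distrib]
    refine prod_congr rfl fun s hs => ?_
    rw [mem_range] at hs
    rw [show k + m = s + (m + (k - 1 - s) + 1) by omega, pow_add eta s]
    ring
  have h2 : (∏ s ∈ range k, (1 - eta ^ (m + s + 1))) *
      ∏ s ∈ range k, (1 - eta) / (1 - eta ^ (m + s + 1)) = ∏ s ∈ range k, (1 - eta) := by
    rw [← prod_mul_distrib]
    refine prod_congr rfl fun s hs => mul_div_cancel₀ _ (sub_ne_zero.2 (Ne.symm (heta _ ?_)))
    rw [mem_range] at hs
    rw [mem_Icc]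
    omega
  have hsq : ((-1 : F) ^ k) * (-1) ^ k = 1 := by rw [← mul_pow]; simp
  simp only [prod_Icc_one_eq_range]
  rw [add_comm k m, prod_range_add, add_comm m k, prod_div_distrib (s := range k)
    (f := fun s => eta ^ (k + m) - eta ^ s), h1, prod_div_distrib (s := range k)
    (f := fun _ => 1 - eta) (g := fun s => 1 - eta ^ (s + 1)), ← h2, pow_add]
  linear_combination (-(-1) ^ m * eta ^ (k * (k - 1) / 2) *
    (∏ s ∈ range m, (1 - eta) / (1 - eta ^ (s + 1))) *
    ((∏ s ∈ range k, (1 - eta ^ (m + s + 1))) *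
      (∏ s ∈ range k, (1 - eta) / (1 - eta ^ (m + s + 1)))) /
      (∏ s ∈ range k, (1 - eta ^ (s + 1)))) * hsq

theorem eq_one_iff_lt_mult {lam : Fin l → Fin 2} (hlam : Antitone lam) (a : Fin l) :
    lam a = 1 ↔ (a : ℕ) < mult 1 lam := by
  constructor
  · intro h
    have : Iic a ⊆ ({b | lam b = 1} : Finset (Fin l)) := fun b hb => by
      have := hlam (mem_Iic.1 hb)
      rw [mem_filter_univ]
      omega
    have := card_le_card this
    rw [Fin.card_Iic] at this
    exact this
  · intro h
    by_contra hn
    have : ({b | lam b = 1} : Finset (Fin l)) ⊆ Iio a := fun b hb => by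
      rw [mem_filter_univ] at hb
      rw [mem_Iio]
      by_contra hba
      have := hlam (not_lt.1 hba)
      omega
    have := card_le_card this
    rw [Fin.card_Iio] at this
    exact absurd h (not_lt.2 this)

theorem mult_one_add_mult_zero (lam : Fin l → Fin 2) : mult 1 lam + mult 0 lam = l := by
  have h : ∀ a ∈ (univ : Finset (Fin l)), lam a = 0 ↔ ¬ lam a = 1 := fun a _ => by omega
  rw [mult, mult, filter_congr h, card_filter_add_card_filter_not, card_univ, Fintype.card_fin]

/-- For `n = 2` the terms of the linear relation are those of Jing's identity. -/
theorem c_mul_symm_eq_jingTerm (t : Fin l → F) (eta : F) (heta : ∀ s ∈ Icc 1 l, eta ^ s ≠ 1)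
    (x y : Fin 2 → F) (hy : y 0 = 1) (hx : x 1 = eta ^ (l - 1)) {lam : Fin l → Fin 2}
    (hlam : Antitone lam) :
    c 0 1 lam x y eta * (r lam eta *
      ∑ σ : Equiv.Perm (Fin l), (∏ a, Xdiv (lam a) (t (σ a)) x y) *
        ∏ a, ∏ b ∈ Ioi a, (t (σ a) - eta * t (σ b)) / (t (σ a) - t (σ b))) =
    (-1) ^ l * (∏ s ∈ Icc 1 l, (1 - eta) / (1 - eta ^ s)) * jingTerm (mult 1 lam) t eta := by
  set k := mult 1 lam with hk
  have hkm := mult_one_add_mult_zero lam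
  have h01 : ∀ m : Fin 2, Ioo 0 m = ∅ := by decide
  have h10 : ∀ m : Fin 2, Ioo m 1 = ∅ := by decide
  have hc : c 0 1 lam x y eta = (-1) ^ mult 0 lam * eta ^ (k * (k - 1) / 2) := by
    simp [c, h01, h10, ← hk]
  have hr : r lam eta = (∏ s ∈ Icc 1 k, (1 - eta) / (1 - eta ^ s)) *
      ∏ s ∈ Icc 1 (mult 0 lam), (1 - eta) / (1 - eta ^ s) := by
    rw [r, Fin.prod_univ_two, mul_comm, ← hk]
  have hX : ∀ σ : Equiv.Perm (Fin l), ∏ a, Xdiv (lam a) (t (σ a)) x y =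
      (∏ a with (a : Fin l).val < k, (t (σ a) - 1)) *
        ∏ b with k ≤ (b : Fin l).val, (t (σ b) - eta ^ (l - 1)) := by
    intro σ
    rw [prod_filter, prod_filter, ← prod_mul_distrib]
    refine prod_congr rfl fun a _ => ?_
    have ha := eq_one_iff_lt_mult hlam a
    rw [← hk] at ha
    have e0 : Iio (0 : Fin 2) = ∅ := by decide
    have e1 : Ioi (0 : Fin 2) = {1} := by decide
    have e2 : Iio (1 : Fin 2) = {0} := by decide
    have e3 : Ioi (1 : Fin 2) = ∅ := by decide
    by_cases h : (a : ℕ) < k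
    · rw [if_pos h, if_neg (not_le.2 h), ha.2 h, Xdiv, e2, e3]
      simp [hy]
    · have h0 : lam a = 0 := by
        have := mt ha.1 h
        omega
      rw [if_neg h, if_pos (not_lt.1 h), h0, Xdiv, e0, e1]
      simp [hx]
  have hcoef := jing_coeff eta k (mult 0 lam) (by rwa [hkm])
  rw [hkm] at hcoef
  simp only [hX, jingTerm]
  rw [hc, hr, ← mul_assoc, hcoef]
  ring

theorem sum_partitionsBetween_two (w : ℕ → F) :
    ∑ lam ∈ partitionsBetween l (0 : Fin 2) 1, w (mult 1 lam) = ∑ k ∈ range (l + 1), w k := by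
  refine sum_bij' (fun lam _ => mult 1 lam) (fun k _ => fun a => if a.val < k then 1 else 0)
    ?_ ?_ ?_ ?_ fun _ _ => rfl
  · intro lam _
    have := mult_one_add_mult_zero lam
    rw [mem_range]
    omega
  · intro k _
    refine mem_partitionsBetween.2 ⟨fun a b hab => ?_, fun a => ?_⟩
    · have : a.val ≤ b.val := hab
      beta_reduce
      split_ifs <;> omega
    · split_ifs <;> simp
  · intro lam hlam
    funext a
    have := eq_one_iff_lt_mult (mem_partitionsBetween.1 hlam).1 a
    split_ifs with h
    · exact (this.2 h).symm
    · have := mt this.1 h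
      omega
  · intro k hk
    rw [mem_range] at hk
    simp only [mult]
    have : ∀ a ∈ (univ : Finset (Fin l)),
        (if a.val < k then (1 : Fin 2) else 0) = 1 ↔ a.val < k := fun a _ => by simp
    rw [filter_congr this, Fin.card_filter_val_lt]
    omega

theorem sum_jingTerm (hl : 1 ≤ l) (t : Fin l → F) (ht : Function.Injective t) (eta : F)
    (heta : ∀ s ∈ Icc 1 l, eta ^ s ≠ 1) : ∑ k ∈ range (l + 1), jingTerm k t eta = 0 := by
  have h := sum_c_mul_symm_eq_zero hl (show (0 : Fin 2) < 1 by decide) t ht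
    (fun _ => eta ^ (l - 1)) (fun _ => 1) eta heta (by simp)
  rw [sum_congr rfl fun lam hlam => c_mul_symm_eq_jingTerm t eta heta (fun _ => eta ^ (l - 1))
    (fun _ => 1) rfl rfl (mem_partitionsBetween.1 hlam).1, ← mul_sum,
    sum_partitionsBetween_two fun k => jingTerm k t eta] at h
  refine (mul_eq_zero.1 h).resolve_left (mul_ne_zero (by simp) (prod_ne_zero_iff.2 fun s hs => ?_))
  have h1 := heta 1 (mem_Icc.2 ⟨le_rfl, hl⟩)
  rw [pow_one] at h1
  exact div_ne_zero (sub_ne_zero.2 (Ne.symm h1)) (sub_ne_zero.2 (Ne.symm (heta s hs)))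

end Jing

end JingId

theorem theorem1p1 (ℓ : ℕ) (hℓ : 1 ≤ ℓ) :
    -- every `P_lam` is a polynomial in all the indeterminates, and the linear relations hold
    -- whenever the indeterminates take values with `x_j = η^{ℓ-1} y_i` in a commutative ring
    (∀ n : ℕ, ∃ P : (Fin ℓ → Fin n) → MvPolynomial (JingId.Indet ℓ n) ℤ,
      (∀ lam ∈ JingId.partitions ℓ n,
        algebraMap (MvPolynomial (JingId.Indet ℓ n) ℤ) (JingId.RatField ℓ n) (P lam)
          = JingId.PRat lam) ∧
      ∀ i j : Fin n, i < j →
        ∀ (A : Type*) [CommRing A] (t : Fin ℓ → A) (x y : Fin n → A) (eta : A),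
          x j = eta ^ (ℓ - 1) * y i →
          ∑ lam ∈ JingId.partitionsBetween ℓ i j,
            JingId.c i j lam x y eta *
              MvPolynomial.aeval (JingId.Indet.assign t x y eta) (P lam) = 0) ∧
    -- for `i = 1`, `j = n = 2`, `y_1 = 1` the relation is Jing's identity, term by term and up to
    -- a common factor; the term of `lam` corresponds to `k` = the multiplicity of the part `2`
    (∀ (F : Type*) [Field F] (t : Fin ℓ → F) (eta : F), Function.Injective t →
      (∀ s ∈ Finset.Icc 1 ℓ, eta ^ s ≠ 1) →
      (∀ x y : Fin 2 → F, y 0 = 1 → x 1 = eta ^ (ℓ - 1) →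
        ∀ lam ∈ JingId.partitionsBetween ℓ (0 : Fin 2) 1,
          JingId.c 0 1 lam x y eta * JingId.PFormula lam t x y eta
            = (-1) ^ ℓ * (∏ s ∈ Finset.Icc 1 ℓ, (1 - eta) / (1 - eta ^ s)) * (∏ a, t a) *
                JingId.jingTerm (JingId.mult 1 lam) t eta) ∧
      ∑ k ∈ Finset.range (ℓ + 1), JingId.jingTerm k t eta = 0) := by
  refine ⟨fun n => ⟨JingId.PPoly, fun lam hlam =>
    JingId.algebraMap_PPoly (JingId.mem_partitions.1 hlam),
    fun i j hij A _ t x y eta hx => JingId.sum_c_mul_PPoly hℓ hij t x y eta hx⟩,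
    fun F _ t eta ht heta => ⟨fun x y hy hx lam hlam => ?_, JingId.sum_jingTerm hℓ t ht eta heta⟩⟩
  rw [JingId.PFormula_eq_prod_mul, mul_left_comm, JingId.c_mul_symm_eq_jingTerm t eta heta x y hy hx
    (JingId.mem_partitionsBetween.1 hlam).1]
  ring
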